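/- Let $\alpha\in(1,\infty)$ and $\beta\in[1,\infty)$. Let $\mathcal X_0,\mathcal Y\subseteq\mathbb R$ be Borel sets such that every point of $\mathcal X_0$ is a limit of interior points of $\mathcal X_0$ (for instance intervals, or $\mathbb R$), and let $X,Y$ be real random variables with a joint probability density $f_{XY}$ that vanishes off $\mathcal X_0\times\mathcal Y$ and is continuous on $\mathcal X_0\times\mathcal Y$. Write $f_X(x)=\int f_{XY}(x,y)\,dy$, let $\mathcal X=\{x: 0<f_X(x)<\infty\}$ be the alphabet of $X$, and for $x\in\mathcal X$ let $f_{Y|X}(y|x)=f_{XY}(x,y)/f_X(x)$. The maximal $(\alpha,\beta)$-leakage from $X$ to $Y$ is $$\mathcal L_{\alpha,\beta}(X\to Y)=\sup_{P_X}\ \sup_{U\to X\to Y}\ \frac{\alpha}{\alpha-1}\log\frac{\max_{P_{\hat U|Y}}\Big[\mathbb E_Y\Big[\big(\sum_u P_{U|Y}(u|Y)\,P_{\hat U|Y}(u|Y)^{\frac{\alpha-1}{\alpha}}\big)^{\beta}\Big]\Big]^{1/\beta}}{\max_{P_{\hat U}}\sum_u P_U(u)\,P_{\hat U}(u)^{\frac{\alpha-1}{\alpha}}},$$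 where $P_X$ ranges over all probability distributions on $\mathcal X$, $U$ over all randomized functions of $X$ with an arbitrary finite alphabet such that $U\to X\to Y$ is a Markov chain with channel $f_{Y|X}$ from $X$ to $Y$, and $\hat U$ is an estimator with values in the alphabet of $U$. Then, as an equality in $[-\infty,+\infty]$, $$\mathcal L_{\alpha,\beta}(X\to Y)=\sup_{x':\,0<f_X(x')<\infty}\ \sup_{f_{\tilde X}}\ \frac{\alpha}{(\alpha-1)\beta}\log\int_{\mathcal Y} f_{Y|X}(y|x')^{1-\beta}\Big(\int_{\mathcal X} f_{\tilde X}(x)\,f_{Y|X}(y|x)^{\alpha}\,dx\Big)^{\beta/\alpha}dy,$$ where $f_{\tilde X}$ ranges over all probability density functions on $\mathcal X$, with the conventions $0^{1-\beta}=+\infty$ for $\beta>1$, $0^0=1$ and $\infty\cdot 0=0$. -/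

import Mathlib

open MeasureTheory ProbabilityTheory
open scoped ENNReal NNReal

namespace AlphaBetaLeakage

noncomputable section

/-! ### The operational definition, for an arbitrary channel

`W` is the channel `P_{Y|X}`, `P` a distribution `P_X` on the input alphabet and `κ` a channel
`P_{U|X}` into a finite alphabet; together they give a Markov chain `U → X → Y`. -/

/-- The joint law of `U` and `Y`: `B ↦ P(U = u, Y ∈ B) = ∫ P_{U|X}(u|x) P_{Y|X}(B|x) P_X(dx)`. -/
def jointLaw {A B : Type*} [MeasurableSpace A] [MeasurableSpace B] {n : ℕ}
    (P : Measure A) (W : Kernel A B) (κ : Kernel A (Fin n)) (u : Fin n) : Measure B :=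
  (P.withDensity (fun x => κ x {u})).bind W

/-- The conditional probability `P_{U|Y}(u|y)`, the density of `P(U = u, Y ∈ ·)` with respect to
the law `P_Y = P.bind W` of `Y`. -/
def posterior {A B : Type*} [MeasurableSpace A] [MeasurableSpace B] {n : ℕ}
    (P : Measure A) (W : Kernel A B) (κ : Kernel A (Fin n)) (u : Fin n) (y : B) : ℝ≥0∞ :=
  (jointLaw P W κ u).rnDeriv (P.bind W) y

/-- `[E_Y[(∑_u P_{U|Y}(u|Y) P_{Û|Y}(u|Y)^((α-1)/α))^β]]^(1/β)` for the estimator `Q = P_{Û|Y}`. -/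
def informedGain {A B : Type*} [MeasurableSpace A] [MeasurableSpace B] {n : ℕ} (α β : ℝ)
    (P : Measure A) (W : Kernel A B) (κ : Kernel A (Fin n)) (Q : Kernel B (Fin n)) : ℝ≥0∞ :=
  (∫⁻ y, (∑ u, posterior P W κ u y * (Q y {u}) ^ ((α - 1) / α)) ^ β ∂(P.bind W)) ^ (1 / β)

/-- `∑_u P_U(u) P_Û(u)^((α-1)/α)` for the blind estimator `q = P_Û`. -/
def blindGain {A : Type*} [MeasurableSpace A] {n : ℕ} (α : ℝ)
    (P : Measure A) (κ : Kernel A (Fin n)) (q : Measure (Fin n)) : ℝ≥0∞ :=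
  ∑ u, (P.bind κ) {u} * (q {u}) ^ ((α - 1) / α)

/-- Maximal `(α,β)`-leakage of the channel `W`, for `1 < α < ∞` and `1 ≤ β < ∞`. -/
def maximalLeakage {A B : Type*} [MeasurableSpace A] [MeasurableSpace B] (α β : ℝ)
    (W : Kernel A B) : EReal :=
  ⨆ (P : Measure A) (_ : IsProbabilityMeasure P) (n : ℕ) (κ : Kernel A (Fin n))
    (_ : IsMarkovKernel κ),
    ((α / (α - 1) : ℝ) : EReal) *
      ENNReal.log
        ((⨆ (Q : Kernel B (Fin n)) (_ : IsMarkovKernel Q), informedGain α β P W κ Q) /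
          (⨆ (q : Measure (Fin n)) (_ : IsProbabilityMeasure q), blindGain α P κ q))

/-! ### The channel of a pair of real random variables with joint density `f` -/

/-- The marginal density `f_X(x) = ∫ f(x,y) dy`. -/
def marginalPDF (f : ℝ × ℝ → ℝ≥0) (x : ℝ) : ℝ≥0∞ := ∫⁻ y, f (x, y)

/-- The input alphabet: the points with `f_X(x) > 0` at which `f_{Y|X}(·|x)` is defined. The
condition `f_X(x) < ∞` can fail only on a null set. -/
def inputAlphabet (f : ℝ × ℝ → ℝ≥0) : Set ℝ := {x | 0 < marginalPDF f x ∧ marginalPDF f x < ∞}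

/-- The conditional density `f_{Y|X}(y|x) = f(x,y) / f_X(x)`. -/
def condPDF (f : ℝ × ℝ → ℝ≥0) (x y : ℝ) : ℝ≥0∞ := f (x, y) / marginalPDF f x

/-- The conditional distribution of `Y` given `X = x`, with density `f_{Y|X}(·|x)`. -/
def channel (f : ℝ × ℝ → ℝ≥0) : Kernel (inputAlphabet f) ℝ :=
  Kernel.withDensity (Kernel.const _ volume) (fun x y => condPDF f x y)

/-- `g` is a probability density function on the set `S` of real numbers. -/
def IsPDFOn (S : Set ℝ) (g : ℝ → ℝ≥0∞) : Prop := Measurable g ∧ ∫⁻ x in S, g x = 1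

end

end AlphaBetaLeakage

/-!
Write `w x y` for the conditional density and, for a probability measure `P` on the alphabet,
`J x' P = ∫ w x' y ^ (1 - β) * (∫ w x y ^ α ∂P) ^ (β / α) dy` (`leakageIntegral`). The right-hand
side of the theorem is, up to the increasing map `c * log`, the supremum of `J x' P` over those `P`
that have a density. The proof shows that the left-hand side is the supremum of `J x' P` over all
`P`, and that neither restricting `P` to densities nor to finitely supported measures changes it.

*Operational side.* By Hölder's inequality the best estimators are proportional to the `α`-th power
of the (posterior or prior) probabilities, so the leakage is the supremum of `c * log` of
`gainRatio ρ` over finite families `ρ u = P(U = u, X ∈ ·)` of measures of total mass one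
(`maximalLeakage_eq_iSup`).

*Upper bound* (`gainRatio_le`). Jensen's inequality for `t ^ α` and for `t ^ (1 - β)` bounds
`gainRatio ρ` by an average over `x'` of `J x' T`, where `T` mixes the laws of `X` given `U = u`
with weights proportional to `P(U = u) ^ α`.

*Lower bound* (`leakageIntegral_dirac_le`). For `P = ∑ p i δ_{x i}`, let `X` be equal to `x'` except
with a small probability `ε`, when it is `x i` with probability proportional to `p i ^ (1 / α)`;
`U` reveals the index `i` in the exceptional case and is otherwise uniform on `k` further symbols.
As `k → ∞` the latter cease to count in the sums of `α`-th powers, and as `ε → 0` the law of `Y`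
tends to `w x'`, which leaves at least `J x' P`.

*Approximation* (`leakageIntegral_le_of_mixtures`). Let `𝒬` be a family of probability measures on
the alphabet, some member of which lives on any given nonempty open set. The claim is that the
supremum of `J` over finite mixtures of `𝒬` is its supremum over all `P`; it is applied to the Dirac
measures and to the densities. If `w · y` is continuous for every `y`, this is Fatou's lemma. In
general `w x y = f (x, y) / f_X x`, where `f_X` is only lower semicontinuous. If `f_X` jumps upwards
near `x₀`, then some mass of `w x ·` escapes as `x → x₀`, so that mixtures of many such
distributions behave like mixtures of densities with disjoint supports, and `J` is unbounded
(`eq_top_of_escaping`): then both suprema are infinite.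
-/

namespace AlphaBetaLeakage

/-! ### Weighted Hölder inequality and finite estimators -/

/-- Hölder's inequality with a weight. It contains Jensen's inequality for `t ^ β` (take `w = 1`)
and for `t ^ (1 - β)` (take `φ = 1`). -/
theorem rpow_lintegral_le_weighted {E : Type*} [MeasurableSpace E] {μ : Measure E}
    {w φ : E → ℝ≥0∞} (hw : Measurable w) (hφ : Measurable φ) (hwtop : ∀ x, w x ≠ ∞)
    (hw0 : ∫⁻ x, w x ∂μ ≠ 0) {β : ℝ} (hβ : 1 ≤ β) :
    (∫⁻ x, φ x ∂μ) ^ β ≤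
      (∫⁻ x, w x ∂μ) ^ (β - 1) * ∫⁻ x, w x ^ (1 - β) * φ x ^ β ∂μ := by
  rcases hβ.eq_or_lt with rfl | hβ
  · simp
  have hβ0 : 0 < β := by linarith
  rcases eq_or_ne (∫⁻ x, w x ^ (1 - β) * φ x ^ β ∂μ) ∞ with hK | hK
  · rw [hK, ENNReal.mul_top]
    · exact le_top
    · exact (ENNReal.rpow_pos_of_nonneg (pos_iff_ne_zero.2 hw0) (by linarith)).ne'
  have hm : Measurable fun x => w x ^ (1 - β) * φ x ^ β := by fun_prop
  have hpt : ∀ᵐ x ∂μ, φ x ≤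
      w x ^ ((β - 1) / β) * (w x ^ (1 - β) * φ x ^ β) ^ (1 / β) := by
    filter_upwards [ae_lt_top hm hK] with x hx
    rcases eq_or_ne (w x) 0 with h0 | h0
    · -- a zero weight forces `φ x = 0`, since `0 ^ (1 - β) = ∞`
      rw [h0, ENNReal.zero_rpow_of_neg (by linarith)] at hx
      have : φ x = 0 := by
        by_contra hne
        have : φ x ^ β ≠ 0 := (ENNReal.rpow_pos_of_nonneg (pos_iff_ne_zero.2 hne) hβ0.le).ne'
        rw [ENNReal.top_mul this] at hx
        exact lt_irrefl _ hx
      simp [this]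
    · refine le_of_eq ?_
      rw [ENNReal.mul_rpow_of_nonneg _ _ (by positivity), ← ENNReal.rpow_mul, ← ENNReal.rpow_mul,
        ← mul_assoc, ← ENNReal.rpow_add _ _ h0 (hwtop x)]
      rw [show (β - 1) / β + (1 - β) * (1 / β) = 0 by ring, mul_one_div_cancel hβ0.ne']
      simp
  have hpq : (β / (β - 1)).HolderConjugate β := (Real.HolderConjugate.conjExponent hβ).symm
  have hH : ∫⁻ x, φ x ∂μ ≤ (∫⁻ x, w x ∂μ) ^ ((β - 1) / β) *
      (∫⁻ x, w x ^ (1 - β) * φ x ^ β ∂μ) ^ (1 / β) := by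
    refine (lintegral_mono_ae hpt).trans ?_
    refine (ENNReal.lintegral_mul_le_Lp_mul_Lq μ hpq (by fun_prop) (by fun_prop)).trans ?_
    refine le_of_eq ?_
    congr 2
    · refine lintegral_congr fun x => ?_
      rw [← ENNReal.rpow_mul, div_mul_div_cancel₀ hβ0.ne', div_self (by linarith), ENNReal.rpow_one]
    · field_simp
    · refine lintegral_congr fun x => ?_
      rw [← ENNReal.rpow_mul, one_div_mul_cancel hβ0.ne', ENNReal.rpow_one]
  calc (∫⁻ x, φ x ∂μ) ^ β ≤ _ := ENNReal.rpow_le_rpow hH hβ0.le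
    _ = _ := by
      rw [ENNReal.mul_rpow_of_nonneg _ _ hβ0.le, ← ENNReal.rpow_mul, ← ENNReal.rpow_mul,
        one_div_mul_cancel hβ0.ne', ENNReal.rpow_one, div_mul_cancel₀ _ hβ0.ne']

/-- The gain of any estimator `q` is at most the `ℓ^α` norm of `a`. -/
theorem sum_mul_rpow_le {ι : Type*} [Fintype ι] {α : ℝ} (hα : 1 < α) (a q : ι → ℝ≥0∞)
    (hq : ∑ u, q u = 1) :
    ∑ u, a u * q u ^ ((α - 1) / α) ≤ (∑ u, a u ^ α) ^ (1 / α) := by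
  have hpq : α.HolderConjugate (α / (α - 1)) := Real.HolderConjugate.conjExponent hα
  refine (ENNReal.inner_le_Lp_mul_Lq Finset.univ a (fun u => q u ^ ((α - 1) / α)) hpq).trans ?_
  have : ∀ u, (q u ^ ((α - 1) / α)) ^ (α / (α - 1)) = q u := fun u => by
    rw [← ENNReal.rpow_mul, div_mul_div_cancel₀ (by linarith), div_self (by linarith),
      ENNReal.rpow_one]
  simp [this, hq]

/-- The estimator proportional to `a ^ α` attains the bound of `sum_mul_rpow_le`. -/
theorem sum_mul_rpow_eq {ι : Type*} [Fintype ι] {α : ℝ} (hα : 1 < α) (a : ι → ℝ≥0∞)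
    (h0 : ∑ u, a u ^ α ≠ 0) (htop : ∑ u, a u ^ α ≠ ∞) :
    ∑ u, a u * (a u ^ α / ∑ v, a v ^ α) ^ ((α - 1) / α) = (∑ u, a u ^ α) ^ (1 / α) := by
  have hα0 : 0 < α := by linarith
  set S := ∑ u, a u ^ α with hS
  have hterm : ∀ u, a u * (a u ^ α / S) ^ ((α - 1) / α) = a u ^ α / S ^ ((α - 1) / α) := by
    intro u
    have he : 0 ≤ (α - 1) / α := div_nonneg (by linarith) hα0.le
    rw [ENNReal.div_rpow_of_nonneg _ _ he, ← ENNReal.rpow_mul, mul_div_cancel₀ _ hα0.ne',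
      ← mul_div_assoc]
    congr 1
    nth_rewrite 1 [← ENNReal.rpow_one (a u)]
    rw [← ENNReal.rpow_add_of_nonneg _ _ zero_le_one (by linarith)]
    congr 1; ring
  simp_rw [hterm, div_eq_mul_inv]
  rw [← Finset.sum_mul, ← hS, ← ENNReal.rpow_neg]
  nth_rewrite 1 [← ENNReal.rpow_one S]
  rw [← ENNReal.rpow_add _ _ h0 htop]
  congr 1; field_simp; ring

theorem exists_kernel_apply_singleton {B : Type*} [MeasurableSpace B] {n : ℕ}
    (q : B → Fin n → ℝ≥0∞) (hq : ∀ u, Measurable fun y => q y u) (hsum : ∀ y, ∑ u, q y u = 1) :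
    ∃ Q : Kernel B (Fin n), IsMarkovKernel Q ∧ ∀ y u, Q y {u} = q y u := by
  refine ⟨⟨fun y => ∑ u, q y u • Measure.dirac u, ?_⟩, ⟨fun y => ⟨?_⟩⟩, fun y u => ?_⟩
  · refine Measure.measurable_of_measurable_coe _ fun s hs => ?_
    simp only [Measure.coe_finsetSum, Finset.sum_apply, Measure.smul_apply, smul_eq_mul]
    exact Finset.measurable_fun_sum _ fun u _ => (hq u).mul_const _
  · simp [hsum y]
  · simp [Set.indicator_apply]

theorem sum_singleton_eq_one {n : ℕ} (m : Measure (Fin n))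
    [IsProbabilityMeasure m] : ∑ u, m {u} = 1 := by
  rw [sum_measure_singleton]; simp

/-! ### Optimal estimators and the leakage as a supremum over joint laws -/

theorem iSup_blindGain {A : Type*} [MeasurableSpace A] {n : ℕ} {α : ℝ} (hα : 1 < α)
    (P : Measure A) [IsProbabilityMeasure P] (κ : Kernel A (Fin n)) [IsMarkovKernel κ] :
    ⨆ (q : Measure (Fin n)) (_ : IsProbabilityMeasure q), blindGain α P κ q =
      (∑ u, (P.bind κ) {u} ^ α) ^ (1 / α) := by
  have hα0 : 0 < α := by linarith
  refine le_antisymm (iSup₂_le fun q hq => sum_mul_rpow_le hα _ _ (sum_singleton_eq_one q)) ?_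
  have h1 : ∑ u, (P.bind κ) {u} = 1 := sum_singleton_eq_one _
  have h0 : ∑ u, (P.bind κ) {u} ^ α ≠ 0 := by
    intro h
    have : ∀ u, (P.bind κ) {u} = 0 := fun u => by
      simpa [hα0, hα0.not_gt] using (Finset.sum_eq_zero_iff.1 h) u (Finset.mem_univ u)
    simp [this] at h1
  have htop : ∑ u, (P.bind κ) {u} ^ α ≠ ∞ :=
    ENNReal.sum_ne_top.2 fun u _ => ENNReal.rpow_ne_top_of_nonneg hα0.le (measure_ne_top _ _)
  obtain ⟨Q, hQ, hQu⟩ := exists_kernel_apply_singleton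
    (fun (_ : Unit) u => (P.bind κ) {u} ^ α / ∑ v, (P.bind κ) {v} ^ α)
    (fun u => measurable_const) (fun _ => by
      simp_rw [div_eq_mul_inv]
      rw [← Finset.sum_mul, ENNReal.mul_inv_cancel h0 htop])
  refine le_iSup₂_of_le (Q ()) inferInstance ?_
  rw [blindGain]
  simp_rw [hQu]
  exact (sum_mul_rpow_eq hα _ h0 htop).ge

/-- The pointwise optimal estimator is a measurable function of the observation, so the supremum
over kernels can be taken under the integral. -/
theorem iSup_informedGain {A B : Type*} [MeasurableSpace A] [MeasurableSpace B] {n : ℕ} (hn : 0 < n)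
    {α β : ℝ} (hα : 1 < α) (hβ : 1 ≤ β) (P : Measure A) (W : Kernel A B) (κ : Kernel A (Fin n))
    [∀ u, SigmaFinite (jointLaw P W κ u)] :
    ⨆ (Q : Kernel B (Fin n)) (_ : IsMarkovKernel Q), informedGain α β P W κ Q =
      (∫⁻ y, (∑ u, posterior P W κ u y ^ α) ^ (β / α) ∂(P.bind W)) ^ (1 / β) := by
  have hα0 : 0 < α := by linarith
  have hβ0 : 0 < β := by linarith
  have hpow : ∀ s : ℝ≥0∞, (s ^ (1 / α)) ^ β = s ^ (β / α) := fun s => by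
    rw [← ENNReal.rpow_mul]; congr 1; ring
  refine le_antisymm (iSup₂_le fun Q hQ => ?_) ?_
  · refine ENNReal.rpow_le_rpow (lintegral_mono fun y => ?_) (by positivity)
    rw [← hpow]
    exact ENNReal.rpow_le_rpow (sum_mul_rpow_le hα _ _ (sum_singleton_eq_one _)) hβ0.le
  have hm : ∀ u, Measurable fun y => posterior P W κ u y := fun u => Measure.measurable_rnDeriv _ _
  let S : B → ℝ≥0∞ := fun y => ∑ u, posterior P W κ u y ^ α
  have hS : Measurable S := by
    exact Finset.measurable_fun_sum _ fun u _ => (hm u).pow_const _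
  have hbad : MeasurableSet {y | S y = 0 ∨ S y = ∞} :=
    (hS (measurableSet_singleton 0)).union (hS (measurableSet_singleton ∞))
  -- any estimator will do where `S = ∞`, which is a null set, or `S = 0`, where the gain is zero
  classical
  obtain ⟨Q, hQ, hQu⟩ := exists_kernel_apply_singleton
    (fun y u => if y ∈ {y | S y = 0 ∨ S y = ∞} then (if u = ⟨0, hn⟩ then 1 else 0) else
      posterior P W κ u y ^ α / S y)
    (fun u => Measurable.ite hbad measurable_const (((hm u).pow_const _).div hS))
    (fun y => by
      by_cases hy : y ∈ {y | S y = 0 ∨ S y = ∞}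
      · simp only [if_pos hy]; simp
      · simp only [if_neg hy]
        simp only [Set.mem_ofPred_eq, not_or] at hy
        simp_rw [div_eq_mul_inv]
        rw [← Finset.sum_mul]
        exact ENNReal.mul_inv_cancel hy.1 hy.2)
  refine le_iSup₂_of_le Q hQ ?_
  refine ENNReal.rpow_le_rpow (lintegral_mono_ae ?_) (by positivity)
  have hlt : ∀ᵐ y ∂(P.bind W), ∀ u, posterior P W κ u y < ∞ :=
    ae_all_iff.2 fun u => Measure.rnDeriv_lt_top _ _
  filter_upwards [hlt] with y hy
  rw [← hpow]
  refine ENNReal.rpow_le_rpow ?_ hβ0.le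
  have htop : S y ≠ ∞ :=
    ENNReal.sum_ne_top.2 fun u _ => ENNReal.rpow_ne_top_of_nonneg hα0.le (hy u).ne
  rcases eq_or_ne (S y) 0 with h0 | h0
  · change S y ^ (1 / α) ≤ _
    rw [h0, ENNReal.zero_rpow_of_pos (by positivity)]
    exact zero_le
  · have hy' : y ∉ {y | S y = 0 ∨ S y = ∞} := by simp [h0, htop]
    simp_rw [hQu, if_neg hy']
    exact (sum_mul_rpow_eq hα _ h0 htop).ge

/-- The density of the law of `Y` when the input has distribution `P` and the channel has
conditional density `w`; `P` may have any total mass. -/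
noncomputable def mixture {A B : Type*} [MeasurableSpace A] (w : A → B → ℝ≥0∞)
    (P : Measure A) (y : B) : ℝ≥0∞ :=
  ∫⁻ x, w x y ∂P

/-- The `β`-th power of the ratio of the informed to the blind gain under optimal estimators, for
`ρ u = P(U = u, X ∈ ·)`. Where the density of `Y` vanishes, so do all the other mixtures, and the
integrand is zero whatever the first factor. -/
noncomputable def gainRatio {A B ι : Type*} [MeasurableSpace A] [MeasurableSpace B] [Fintype ι]
    (α β : ℝ) (ν : Measure B) (w : A → B → ℝ≥0∞) (ρ : ι → Measure A) : ℝ≥0∞ :=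
  (∫⁻ y, mixture w (∑ u, ρ u) y ^ (1 - β) * (∑ u, mixture w (ρ u) y ^ α) ^ (β / α) ∂ν) /
    (∑ u, ρ u Set.univ ^ α) ^ (β / α)

section Density

variable {A B : Type*} [MeasurableSpace A] [MeasurableSpace B] {ν : Measure B} [SFinite ν]
  {w : A → B → ℝ≥0∞}

theorem measurable_mixture (hw : Measurable (Function.uncurry w)) (P : Measure A) [SFinite P] :
    Measurable (mixture w P) :=
  hw.lintegral_prod_left'

theorem lintegral_mixture (hw : Measurable (Function.uncurry w))
    (hw1 : ∀ x, ∫⁻ y, w x y ∂ν = 1) (P : Measure A) [SFinite P] :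
    ∫⁻ y, mixture w P y ∂ν = P Set.univ := by
  simp only [mixture]
  rw [← lintegral_lintegral_swap hw.aemeasurable]
  simp [hw1]

theorem bind_withDensity (hw : Measurable (Function.uncurry w)) (P : Measure A) [SFinite P] :
    P.bind (Kernel.withDensity (Kernel.const A ν) w) = ν.withDensity (mixture w P) := by
  ext s hs
  rw [Measure.bind_apply hs (Kernel.aemeasurable _), withDensity_apply _ hs]
  simp_rw [Kernel.withDensity_apply' _ hw, Kernel.const_apply]
  exact lintegral_lintegral_swap hw.aemeasurable

omit [MeasurableSpace B] in
theorem mixture_sum {ι : Type*} [Fintype ι] (ρ : ι → Measure A) (y : B) :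
    mixture w (∑ u, ρ u) y = ∑ u, mixture w (ρ u) y := by
  simp [mixture, lintegral_finsetSum_measure]

omit [SFinite ν] in
theorem rnDeriv_withDensity_of_le {a b : B → ℝ≥0∞} (ha : Measurable a) (hb : Measurable b)
    (hab : a ≤ b) (hbi : ∫⁻ y, b y ∂ν ≠ ∞) :
    (ν.withDensity a).rnDeriv (ν.withDensity b) =ᵐ[ν.withDensity b] fun y => a y / b y := by
  have : IsFiniteMeasure (ν.withDensity b) := isFiniteMeasure_withDensity hbi
  have h : ν.withDensity a = (ν.withDensity b).withDensity (fun y => a y / b y) := by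
    rw [← withDensity_mul (g := fun y => a y / b y) _ hb (ha.div hb)]
    refine withDensity_congr_ae ?_
    filter_upwards [ae_lt_top hb hbi] with y hy
    rcases eq_or_ne (b y) 0 with h0 | h0
    · have : a y = 0 := le_antisymm (h0 ▸ hab y) (zero_le)
      simp [this]
    · simp only [Pi.mul_apply]
      rw [ENNReal.mul_div_cancel h0 hy.ne]
  rw [h]
  exact Measure.rnDeriv_withDensity _ (ha.div hb)

theorem sum_withDensity_kernel {n : ℕ} (P : Measure A) (κ : Kernel A (Fin n)) [IsMarkovKernel κ] :
    ∑ u, P.withDensity (fun x => κ x {u}) = P := by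
  ext s hs
  simp only [Measure.coe_finsetSum, Finset.sum_apply]
  simp_rw [withDensity_apply _ hs]
  rw [← lintegral_finsetSum _ fun u _ => κ.measurable_coe (measurableSet_singleton u)]
  simp

theorem iSup_informedGain_div (hw : Measurable (Function.uncurry w))
    (hw1 : ∀ x, ∫⁻ y, w x y ∂ν = 1) {n : ℕ} {α β : ℝ} (hα : 1 < α) (hβ : 1 ≤ β) (P : Measure A)
    [IsProbabilityMeasure P] (κ : Kernel A (Fin n)) [IsMarkovKernel κ] :
    (⨆ (Q : Kernel B (Fin n)) (_ : IsMarkovKernel Q),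
        informedGain α β P (Kernel.withDensity (Kernel.const A ν) w) κ Q) /
      (⨆ (q : Measure (Fin n)) (_ : IsProbabilityMeasure q), blindGain α P κ q) =
    gainRatio α β ν w (fun u => P.withDensity fun x => κ x {u}) ^ (1 / β) := by
  have hα0 : 0 < α := by linarith
  have hβ0 : 0 < β := by linarith
  set ρ : Fin n → Measure A := fun u => P.withDensity fun x => κ x {u} with hρ
  have hρP : ∑ u, ρ u = P := sum_withDensity_kernel P κ
  have hn : 0 < n := by
    rcases Nat.eq_zero_or_pos n with rfl | h
    · have := measure_univ (μ := P)
      rw [← hρP] at this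
      simp at this
    · exact h
  have hρle : ∀ u, ρ u ≤ P := fun u => by
    conv_rhs => rw [← hρP]
    exact Finset.single_le_sum (f := ρ) (fun _ _ => Measure.zero_le _) (Finset.mem_univ u)
  have hfin : ∀ u, IsFiniteMeasure (ρ u) := fun u => isFiniteMeasure_of_le P (hρle u)
  set b := mixture w P with hb
  have hbm : Measurable b := measurable_mixture hw P
  have hbint : ∫⁻ y, b y ∂ν ≠ ∞ := by rw [lintegral_mixture hw hw1]; exact measure_ne_top _ _
  have hJ : ∀ u, jointLaw P (Kernel.withDensity (Kernel.const A ν) w) κ u =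
      ν.withDensity (mixture w (ρ u)) := fun u => bind_withDensity hw (ρ u)
  have hab : ∀ u, mixture w (ρ u) ≤ b := fun u y => lintegral_mono' (hρle u) le_rfl
  have hJfin : ∀ u, SigmaFinite (jointLaw P (Kernel.withDensity (Kernel.const A ν) w) κ u) := by
    intro u
    rw [hJ]
    have : IsFiniteMeasure (ν.withDensity (mixture w (ρ u))) := isFiniteMeasure_withDensity (by
      rw [lintegral_mixture hw hw1]; exact measure_ne_top _ _)
    infer_instance
  rw [iSup_informedGain hn hα hβ, iSup_blindGain hα, gainRatio,
    ENNReal.div_rpow_of_nonneg _ _ (by positivity)]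
  congr 1
  · congr 1
    rw [hρP, bind_withDensity hw, ← hb]
    have hpost : ∀ᵐ y ∂(ν.withDensity b), ∀ u,
        posterior P (Kernel.withDensity (Kernel.const A ν) w) κ u y = mixture w (ρ u) y / b y := by
      refine ae_all_iff.2 fun u => ?_
      have := rnDeriv_withDensity_of_le (measurable_mixture hw (ρ u)) hbm (hab u) hbint
      filter_upwards [this] with y hy
      rw [posterior, hJ, bind_withDensity hw, ← hb, hy]
    have h1 : ∫⁻ y, (∑ u, posterior P (Kernel.withDensity (Kernel.const A ν) w) κ u y ^ α) ^ (β / α)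
        ∂(ν.withDensity b) = ∫⁻ y, (∑ u, (mixture w (ρ u) y / b y) ^ α) ^ (β / α)
        ∂(ν.withDensity b) := by
      refine lintegral_congr_ae ?_
      filter_upwards [hpost] with y hy
      simp [hy]
    have hmm : ∀ u, Measurable (mixture w (ρ u)) := fun u => measurable_mixture hw _
    rw [h1, lintegral_withDensity_eq_lintegral_mul _ hbm (by fun_prop)]
    refine lintegral_congr_ae ?_
    filter_upwards [ae_lt_top hbm hbint] with y hy
    simp only [Pi.mul_apply]
    rcases eq_or_ne (b y) 0 with h0 | h0
    · have : ∀ u, mixture w (ρ u) y = 0 := fun u => le_antisymm (h0 ▸ hab u y) (zero_le)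
      simp [h0, this, hα0, hβ0]
    · simp_rw [div_eq_mul_inv, ENNReal.mul_rpow_of_nonneg _ _ hα0.le]
      rw [← Finset.sum_mul, ENNReal.mul_rpow_of_nonneg _ _ (by positivity), ← ENNReal.rpow_neg_one,
        ← ENNReal.rpow_mul, ← ENNReal.rpow_mul, mul_comm (_ ^ _) (b y ^ _), ← mul_assoc]
      congr 1
      nth_rewrite 1 [← ENNReal.rpow_one (b y)]
      rw [← ENNReal.rpow_add _ _ h0 hy.ne]
      congr 1; field_simp; ring
  · rw [← ENNReal.rpow_mul]
    congr 1
    · refine Finset.sum_congr rfl fun u _ => ?_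
      rw [Measure.bind_apply (measurableSet_singleton u) κ.aemeasurable, withDensity_apply _ .univ,
        setLIntegral_univ]
    · field_simp

/-- Every finite family of measures on the input alphabet with total mass one is the joint law of
the input and some randomized function `U` of it. -/
theorem exists_kernel_of_sum_eq {n : ℕ} (ρ : Fin n → Measure A)
    [IsProbabilityMeasure (∑ u, ρ u)] :
    ∃ κ : Kernel A (Fin n), IsMarkovKernel κ ∧
      ∀ u, (∑ v, ρ v).withDensity (fun x => κ x {u}) = ρ u := by
  set P := ∑ u, ρ u with hP
  have hρle : ∀ u, ρ u ≤ P := fun u =>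
    Finset.single_le_sum (f := ρ) (fun _ _ => Measure.zero_le _) (Finset.mem_univ u)
  have hfin : ∀ u, IsFiniteMeasure (ρ u) := fun u => isFiniteMeasure_of_le P (hρle u)
  have hn : 0 < n := by
    rcases Nat.eq_zero_or_pos n with rfl | h
    · have := measure_univ (μ := P)
      simp [hP] at this
    · exact h
  have hwd : ∀ u, P.withDensity ((ρ u).rnDeriv P) = ρ u := fun u =>
    Measure.withDensity_rnDeriv_eq _ _ (Measure.absolutelyContinuous_of_le (hρle u))
  have hm : ∀ u, Measurable ((ρ u).rnDeriv P) := fun u => Measure.measurable_rnDeriv _ _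
  have hsm : Measurable fun x => ∑ u, (ρ u).rnDeriv P x :=
    Finset.measurable_fun_sum _ fun u _ => hm u
  have hsum : ∀ᵐ x ∂P, ∑ u, (ρ u).rnDeriv P x = 1 := by
    have : P.withDensity (fun x => ∑ u, (ρ u).rnDeriv P x) = P.withDensity 1 := by
      rw [withDensity_one]
      ext s hs
      rw [withDensity_apply _ hs, lintegral_finsetSum _ fun u _ => hm u]
      simp_rw [← withDensity_apply _ hs, hwd]
      simp [hP]
    exact (withDensity_eq_iff_of_sigmaFinite hsm.aemeasurable aemeasurable_const).1 this
  -- the derivatives sum to one only almost everywhere, so the kernel is redefined on a null set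
  classical
  have hset : MeasurableSet {x | ∑ u, (ρ u).rnDeriv P x = 1} := hsm (measurableSet_singleton 1)
  obtain ⟨κ, hκ, hκu⟩ := exists_kernel_apply_singleton
    (fun x u => if x ∈ {x | ∑ u, (ρ u).rnDeriv P x = 1} then (ρ u).rnDeriv P x else
      (if u = ⟨0, hn⟩ then 1 else 0))
    (fun u => Measurable.ite hset (hm u) measurable_const)
    (fun x => by
      by_cases hx : x ∈ {x | ∑ u, (ρ u).rnDeriv P x = 1}
      · simp only [if_pos hx]; exact hx
      · simp only [if_neg hx]; simp)
  refine ⟨κ, hκ, fun u => ?_⟩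
  rw [← hwd u]
  refine withDensity_congr_ae ?_
  filter_upwards [hsum] with x hx
  rw [hκu]
  exact if_pos hx

/-- Maximal leakage in terms of joint laws of `U` and `X`, with the estimators optimised out. -/
theorem maximalLeakage_eq_iSup (hw : Measurable (Function.uncurry w))
    (hw1 : ∀ x, ∫⁻ y, w x y ∂ν = 1) {α β : ℝ} (hα : 1 < α) (hβ : 1 ≤ β) :
    maximalLeakage α β (Kernel.withDensity (Kernel.const A ν) w) =
      ⨆ (n : ℕ) (ρ : Fin n → Measure A) (_ : IsProbabilityMeasure (∑ u, ρ u)),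
        ((α / ((α - 1) * β) : ℝ) : EReal) * ENNReal.log (gainRatio α β ν w ρ) := by
  have hlog : ∀ t : ℝ≥0∞, ((α / (α - 1) : ℝ) : EReal) * ENNReal.log (t ^ (1 / β)) =
      ((α / ((α - 1) * β) : ℝ) : EReal) * ENNReal.log t := fun t => by
    rw [ENNReal.log_rpow, ← mul_assoc, ← EReal.coe_mul]
    congr 2
    rw [div_mul_div_comm, mul_one]
  refine le_antisymm ?_ ?_
  · refine iSup₂_le fun P hP => iSup_le fun n => iSup₂_le fun κ hκ => ?_
    rw [iSup_informedGain_div hw hw1 hα hβ, hlog]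
    refine le_iSup_of_le n (le_iSup₂_of_le (fun u => P.withDensity fun x => κ x {u}) ?_ le_rfl)
    rw [sum_withDensity_kernel]; exact hP
  · refine iSup_le fun n => iSup₂_le fun ρ hρ => ?_
    obtain ⟨κ, hκ, hκu⟩ := exists_kernel_of_sum_eq ρ
    refine le_iSup₂_of_le (∑ u, ρ u) hρ (le_iSup_of_le n (le_iSup₂_of_le κ hκ ?_))
    rw [iSup_informedGain_div hw hw1 hα hβ, hlog]
    simp_rw [hκu]
    exact le_rfl

end Density

/-! ### From joint laws to the leakage integral and back -/

/-- The integral in the single-letter formula, for a reference point `x'` and a distribution `P` on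
the input alphabet that need not have a density. -/
noncomputable def leakageIntegral {A B : Type*} [MeasurableSpace A] [MeasurableSpace B]
    (α β : ℝ) (ν : Measure B) (w : A → B → ℝ≥0∞) (x' : A) (P : Measure A) : ℝ≥0∞ :=
  ∫⁻ y, w x' y ^ (1 - β) * (∫⁻ x, w x y ^ α ∂P) ^ (β / α) ∂ν

section Reduction

variable {A B : Type*} [MeasurableSpace A] [MeasurableSpace B] {ν : Measure B} [SFinite ν]
  {w : A → B → ℝ≥0∞}

theorem mixture_rpow_le (hw : Measurable (Function.uncurry w)) {α : ℝ} (hα : 1 ≤ α)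
    (P : Measure A) (y : B) :
    mixture w P y ^ α ≤ P Set.univ ^ (α - 1) * ∫⁻ x, w x y ^ α ∂P := by
  rcases eq_or_ne P 0 with rfl | hP
  · have : 0 < α := by linarith
    simp [mixture, this]
  · have h0 : ∫⁻ _, (1 : ℝ≥0∞) ∂P ≠ 0 := by simpa using hP
    simpa [mixture] using rpow_lintegral_le_weighted (μ := P) (w := fun _ => 1)
      (φ := fun x => w x y) measurable_const (hw.of_uncurry_right) (by simp) h0 hα

theorem mixture_rpow_one_sub_le (hw : Measurable (Function.uncurry w)) (hwtop : ∀ x y, w x y ≠ ∞)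
    {β : ℝ} (hβ : 1 ≤ β) (P : Measure A) [IsProbabilityMeasure P] {y : B}
    (h0 : mixture w P y ≠ 0) (htop : mixture w P y ≠ ∞) :
    mixture w P y ^ (1 - β) ≤ ∫⁻ x, w x y ^ (1 - β) ∂P := by
  have h := rpow_lintegral_le_weighted (μ := P) (w := fun x => w x y) (φ := fun _ => 1)
    hw.of_uncurry_right measurable_const (fun x => hwtop x y) h0 hβ
  simp only [lintegral_const, measure_univ, mul_one, ENNReal.one_rpow] at h
  change 1 ≤ mixture w P y ^ (β - 1) * _ at h
  calc mixture w P y ^ (1 - β) = mixture w P y ^ (1 - β) * 1 := (mul_one _).symm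
    _ ≤ mixture w P y ^ (1 - β) *
        (mixture w P y ^ (β - 1) * ∫⁻ x, w x y ^ (1 - β) ∂P) := by gcongr
    _ = ∫⁻ x, w x y ^ (1 - β) ∂P := by
      rw [← mul_assoc, ← ENNReal.rpow_add _ _ h0 htop]
      simp

/-- Jensen's inequality, applied to `t ^ α` for each value of `U` and to `t ^ (1 - β)` for `X`. -/
theorem gainRatio_le (hw : Measurable (Function.uncurry w)) (hwtop : ∀ x y, w x y ≠ ∞)
    (hw1 : ∀ x, ∫⁻ y, w x y ∂ν = 1) {α β : ℝ} (hα : 1 < α) (hβ : 1 ≤ β) {R : ℝ≥0∞}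
    (hR : ∀ x' (P : Measure A), IsProbabilityMeasure P → leakageIntegral α β ν w x' P ≤ R)
    {ι : Type*} [Fintype ι] (ρ : ι → Measure A) [IsProbabilityMeasure (∑ u, ρ u)] :
    gainRatio α β ν w ρ ≤ R := by
  have hα0 : 0 < α := by linarith
  have hβ0 : 0 < β := by linarith
  set P := ∑ u, ρ u with hP
  have hρle : ∀ u, ρ u ≤ P := fun u =>
    Finset.single_le_sum (f := ρ) (fun _ _ => Measure.zero_le _) (Finset.mem_univ u)
  have hfin : ∀ u, IsFiniteMeasure (ρ u) := fun u => isFiniteMeasure_of_le P (hρle u)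
  set p : ι → ℝ≥0∞ := fun u => ρ u Set.univ with hp
  have hp1 : ∑ u, p u = 1 := by
    have : (∑ u, ρ u) Set.univ = 1 := measure_univ
    simpa only [Measure.coe_finsetSum, Finset.sum_apply] using this
  have hS0 : ∑ u, p u ^ α ≠ 0 := by
    intro h
    have : ∀ u, p u = 0 := fun u => by
      simpa [hα0, hα0.not_gt] using (Finset.sum_eq_zero_iff.1 h) u (Finset.mem_univ u)
    simp [this] at hp1
  have hStop : ∑ u, p u ^ α ≠ ∞ :=
    ENNReal.sum_ne_top.2 fun u _ => ENNReal.rpow_ne_top_of_nonneg hα0.le (measure_ne_top _ _)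
  set S := ∑ u, p u ^ α with hS
  have hpp : ∀ u, p u ^ (α - 1) * p u = p u ^ α := fun u => by
    nth_rewrite 2 [← ENNReal.rpow_one (p u)]
    rw [← ENNReal.rpow_add_of_nonneg _ _ (by linarith) zero_le_one]
    simp
  -- the mixture of the conditional laws of `X` given `U = u` with weights `p u ^ α / S`
  let T : Measure A := S⁻¹ • ∑ u, p u ^ (α - 1) • ρ u
  have hT : IsProbabilityMeasure T := ⟨by
    simp only [T, Measure.smul_apply, Measure.coe_finsetSum, Finset.sum_apply, smul_eq_mul]
    change S⁻¹ * ∑ u, p u ^ (α - 1) * p u = 1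
    simp_rw [hpp]
    exact ENNReal.inv_mul_cancel hS0 hStop⟩
  have hsum : ∀ y, ∑ u, mixture w (ρ u) y ^ α ≤ S * ∫⁻ x, w x y ^ α ∂T := fun y => by
    simp only [T, lintegral_smul_measure, lintegral_finsetSum_measure, smul_eq_mul]
    rw [← mul_assoc, ENNReal.mul_inv_cancel hS0 hStop, one_mul]
    exact Finset.sum_le_sum fun u _ => mixture_rpow_le hw hα.le _ y
  have hbint : ∫⁻ y, mixture w P y ∂ν ≠ ∞ := by
    rw [lintegral_mixture hw hw1]; exact measure_ne_top _ _
  rw [gainRatio, ENNReal.div_le_iff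
    (ENNReal.rpow_pos (pos_iff_ne_zero.2 hS0) hStop).ne'
    (ENNReal.rpow_ne_top_of_nonneg (by positivity) hStop)]
  have hF : Measurable fun y => (∫⁻ x, w x y ^ α ∂T) ^ (β / α) :=
    ((hw.pow_const α).lintegral_prod_left').pow_const _
  calc ∫⁻ y, mixture w P y ^ (1 - β) * (∑ u, mixture w (ρ u) y ^ α) ^ (β / α) ∂ν
      ≤ ∫⁻ y, (∫⁻ x', w x' y ^ (1 - β) * (∫⁻ x, w x y ^ α ∂T) ^ (β / α) ∂P) *
          S ^ (β / α) ∂ν := by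
        refine lintegral_mono_ae ?_
        filter_upwards [ae_lt_top (measurable_mixture hw P) hbint] with y hy
        rcases eq_or_ne (mixture w P y) 0 with h0 | h0
        · have : ∀ u, mixture w (ρ u) y = 0 := fun u =>
            le_antisymm (h0 ▸ lintegral_mono' (hρle u) le_rfl) zero_le
          simp [this, hα0, hβ0]
        · rw [lintegral_mul_const _ (hw.of_uncurry_right.pow_const _), mul_assoc]
          refine mul_le_mul' (mixture_rpow_one_sub_le hw hwtop hβ P h0 hy.ne) ?_
          rw [mul_comm, ← ENNReal.mul_rpow_of_nonneg _ _ (by positivity)]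
          exact ENNReal.rpow_le_rpow (hsum y) (by positivity)
    _ = (∫⁻ x', leakageIntegral α β ν w x' T ∂P) * S ^ (β / α) := by
        have hm : Measurable (Function.uncurry fun x' y =>
            w x' y ^ (1 - β) * (∫⁻ x, w x y ^ α ∂T) ^ (β / α)) :=
          (hw.pow_const _).mul (hF.comp measurable_snd)
        have hm' : Measurable fun y => ∫⁻ x', w x' y ^ (1 - β) *
            (∫⁻ x, w x y ^ α ∂T) ^ (β / α) ∂P := hm.lintegral_prod_left'
        rw [lintegral_mul_const _ hm']
        simp only [leakageIntegral]
        rw [lintegral_lintegral_swap hm.aemeasurable]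
    _ ≤ (∫⁻ _, R ∂P) * S ^ (β / α) := by
        gcongr with x'
        exact hR x' T hT
    _ = R * S ^ (β / α) := by simp

omit [SFinite ν] in
theorem gainRatio_equiv {ι κ : Type*} [Fintype ι] [Fintype κ] (e : ι ≃ κ) (α β : ℝ)
    (ρ : κ → Measure A) : gainRatio α β ν w (ρ ∘ e) = gainRatio α β ν w ρ := by
  simp only [gainRatio, Function.comp]
  rw [e.sum_comp ρ, e.sum_comp fun u => ρ u Set.univ ^ α]
  congr 1
  refine lintegral_congr fun y => ?_
  rw [e.sum_comp fun u => mixture w (ρ u) y ^ α]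

theorem mixture_smul_dirac (hw : Measurable (Function.uncurry w)) (c : ℝ≥0∞) (x : A) (y : B) :
    mixture w (c • Measure.dirac x) y = c * w x y := by
  rw [mixture, lintegral_smul_measure, lintegral_dirac' _ hw.of_uncurry_right, smul_eq_mul]

omit [SFinite ν] in
/-- The bound given by an input that is `x'` with probability `1 - ε` and `x i` with probability
`ε * q i`, as the number of symbols that `U` uses for `x'` tends to infinity. -/
theorem lintegral_mix_rpow_le (hw : Measurable (Function.uncurry w)) {α β : ℝ} (hα : 1 < α)
    (hβ : 1 ≤ β) {R : ℝ≥0∞} (hRtop : R ≠ ∞)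
    (hR : ∀ (n : ℕ) (ρ : Fin n → Measure A), IsProbabilityMeasure (∑ u, ρ u) →
      gainRatio α β ν w ρ ≤ R)
    {ι : Type*} [Fintype ι] {p q : ι → ℝ≥0∞} (hp : ∑ i, p i = 1) (hq : ∑ i, q i = 1) {c : ℝ≥0∞}
    (hc0 : c ≠ 0) (hctop : c ≠ ∞) (hqp : ∀ i, q i ^ α = c ^ α * p i) (x : ι → A) (x' : A)
    {ε : ℝ≥0∞} (hε0 : ε ≠ 0) (hε1 : ε ≤ 1) :
    ∫⁻ y, (ε * ∑ i, q i * w (x i) y + (1 - ε) * w x' y) ^ (1 - β) *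
      (∑ i, p i * w (x i) y ^ α) ^ (β / α) ∂ν ≤ R := by
  have hα0 : 0 < α := by linarith
  have hβ0 : 0 < β := by linarith
  have hεtop : ε ≠ ∞ := (hε1.trans_lt ENNReal.one_lt_top).ne
  set I := ∫⁻ y, (ε * ∑ i, q i * w (x i) y + (1 - ε) * w x' y) ^ (1 - β) *
      (∑ i, p i * w (x i) y ^ α) ^ (β / α) ∂ν with hI
  set d := (ε * c) ^ α with hd
  have hd0 : d ≠ 0 := by simp [hd, hε0, hc0, hα0, hα0.not_gt]
  have hdtop : d ≠ ∞ := ENNReal.rpow_ne_top_of_nonneg hα0.le (ENNReal.mul_ne_top hεtop hctop)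
  have hdβ0 : d ^ (β / α) ≠ 0 := (ENNReal.rpow_pos (pos_iff_ne_zero.2 hd0) hdtop).ne'
  have hdβtop : d ^ (β / α) ≠ ∞ := ENNReal.rpow_ne_top_of_nonneg (by positivity) hdtop
  have key : ∀ k : ℕ, I * d ^ (β / α) ≤ R * (d + ((k + 1 : ℕ) : ℝ≥0∞) ^ (1 - α)) ^ (β / α) := by
    intro k
    have hk0 : ((k + 1 : ℕ) : ℝ≥0∞) ≠ 0 := by exact_mod_cast k.succ_ne_zero
    have hktop : ((k + 1 : ℕ) : ℝ≥0∞) ≠ ∞ := ENNReal.natCast_ne_top _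
    set K := ((k + 1 : ℕ) : ℝ≥0∞) with hK
    let ρ : ι ⊕ Fin (k + 1) → Measure A := Sum.elim
      (fun i => (ε * q i) • Measure.dirac (x i)) (fun _ => ((1 - ε) / K) • Measure.dirac x')
    have hρ1 : ∑ u, ρ u =
        ∑ i, (ε * q i) • Measure.dirac (x i) + (1 - ε) • Measure.dirac x' := by
      simp only [ρ, Fintype.sum_sum_type, Sum.elim_inl, Sum.elim_inr, Finset.sum_const,
        Finset.card_univ, Fintype.card_fin]
      rw [← Nat.cast_smul_eq_nsmul ℝ≥0∞, smul_smul, ← hK, ENNReal.mul_div_cancel hk0 hktop]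
    have hprob : IsProbabilityMeasure (∑ u, ρ u) := ⟨by
      rw [hρ1]
      simp only [Measure.coe_add, Measure.coe_finsetSum, Pi.add_apply, Finset.sum_apply,
        Measure.smul_apply, measure_univ, smul_eq_mul, mul_one]
      rw [← Finset.mul_sum, hq, mul_one, add_tsub_cancel_of_le hε1]⟩
    have hle : gainRatio α β ν w ρ ≤ R := by
      let e := (Fintype.equivFin (ι ⊕ Fin (k + 1))).symm
      rw [← gainRatio_equiv e]
      refine hR _ _ ?_
      have : ∑ u, (ρ ∘ e) u = ∑ u, ρ u := e.sum_comp ρ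
      rw [this]; exact hprob
    have hS : ∑ u, ρ u Set.univ ^ α ≤ d + K ^ (1 - α) := by
      simp only [ρ, Fintype.sum_sum_type, Sum.elim_inl, Sum.elim_inr, Finset.sum_const,
        Finset.card_univ, Fintype.card_fin, Measure.smul_apply, measure_univ, smul_eq_mul, mul_one]
      refine add_le_add (le_of_eq ?_) ?_
      · simp_rw [ENNReal.mul_rpow_of_nonneg _ _ hα0.le, hqp]
        rw [← Finset.mul_sum, ← Finset.mul_sum, hp, mul_one, hd,
          ENNReal.mul_rpow_of_nonneg _ _ hα0.le]
      · rw [nsmul_eq_mul, ← hK, ENNReal.rpow_sub _ _ hk0 hktop, ENNReal.rpow_one, div_eq_mul_inv K]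
        gcongr
        rw [← ENNReal.inv_rpow]
        refine ENNReal.rpow_le_rpow ?_ hα0.le
        rw [div_eq_mul_inv]
        exact mul_le_of_le_one_left zero_le tsub_le_self
    have hmix : ∀ y, mixture w (∑ u, ρ u) y =
        ε * ∑ i, q i * w (x i) y + (1 - ε) * w x' y := fun y => by
      rw [hρ1]
      have h1 : mixture w (∑ i, (ε * q i) • Measure.dirac (x i) + (1 - ε) • Measure.dirac x') y =
          mixture w (∑ i, (ε * q i) • Measure.dirac (x i)) y +
            mixture w ((1 - ε) • Measure.dirac x') y := lintegral_add_measure _ _ _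
      rw [h1, mixture_sum]
      simp_rw [mixture_smul_dirac hw]
      rw [Finset.mul_sum]
      simp_rw [mul_assoc]
    have hnum : ∀ y, d * ∑ i, p i * w (x i) y ^ α ≤ ∑ u, mixture w (ρ u) y ^ α := fun y => by
      simp only [ρ, Fintype.sum_sum_type, Sum.elim_inl, Sum.elim_inr]
      refine le_add_right (le_of_eq ?_)
      rw [Finset.mul_sum]
      refine Finset.sum_congr rfl fun i _ => ?_
      rw [mixture_smul_dirac hw, ENNReal.mul_rpow_of_nonneg _ _ hα0.le,
        ENNReal.mul_rpow_of_nonneg _ _ hα0.le, hqp, hd, ENNReal.mul_rpow_of_nonneg _ _ hα0.le]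
      ring
    have hS0 : ∑ u, ρ u Set.univ ^ α ≠ 0 := by
      intro h
      have h2 := measure_univ (μ := ∑ u, ρ u)
      have : ∀ u, ρ u Set.univ = 0 := fun u => by
        simpa [hα0, hα0.not_gt] using (Finset.sum_eq_zero_iff.1 h) u (Finset.mem_univ u)
      rw [Measure.coe_finsetSum, Finset.sum_apply, Finset.sum_eq_zero fun u _ => this u] at h2
      exact zero_ne_one h2
    have hStop : ∑ u, ρ u Set.univ ^ α ≠ ∞ := by
      refine (hS.trans_lt (ENNReal.add_lt_top.2 ⟨hdtop.lt_top, ?_⟩)).ne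
      exact (ENNReal.rpow_ne_top_of_ne_zero hk0 hktop).lt_top
    rw [gainRatio, ENNReal.div_le_iff (ENNReal.rpow_pos (pos_iff_ne_zero.2 hS0) hStop).ne'
      (ENNReal.rpow_ne_top_of_nonneg (by positivity) hStop)] at hle
    calc I * d ^ (β / α) = ∫⁻ y, mixture w (∑ u, ρ u) y ^ (1 - β) *
          (d * ∑ i, p i * w (x i) y ^ α) ^ (β / α) ∂ν := by
          rw [hI, ← lintegral_mul_const' _ _ hdβtop]
          refine lintegral_congr fun y => ?_
          rw [hmix, mul_assoc, ENNReal.mul_rpow_of_nonneg _ _ (by positivity), mul_comm (d ^ _)]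
      _ ≤ _ := by
          refine lintegral_mono fun y => ?_
          gcongr
          exact hnum y
      _ ≤ _ := hle
      _ ≤ _ := by gcongr
  have hlim : Filter.Tendsto (fun k : ℕ => R * (d + ((k + 1 : ℕ) : ℝ≥0∞) ^ (1 - α)) ^ (β / α))
      Filter.atTop (nhds (R * (d + 0) ^ (β / α))) := by
    refine ENNReal.Tendsto.const_mul ?_ (Or.inr hRtop)
    refine (ENNReal.continuous_rpow_const.tendsto _).comp (tendsto_const_nhds.add ?_)
    have h1 : Filter.Tendsto (fun k : ℕ => ((k + 1 : ℕ) : ℝ≥0∞)) Filter.atTop (nhds ∞) :=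
      ENNReal.tendsto_nat_nhds_top.comp (Filter.tendsto_add_atTop_nat 1)
    have h2 := (ENNReal.continuous_rpow_const (y := 1 - α)).tendsto ∞
    rw [ENNReal.top_rpow_of_neg (by linarith)] at h2
    exact h2.comp h1
  have := ge_of_tendsto' hlim key
  rw [add_zero] at this
  exact (ENNReal.mul_le_mul_iff_left hdβ0 hdβtop).1 this

omit [SFinite ν] in
/-- A bound on all gain ratios bounds the leakage integral of finitely supported distributions, by
letting `ε → 0` in `lintegral_mix_rpow_le`. -/
theorem leakageIntegral_dirac_le (hw : Measurable (Function.uncurry w))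
    (hwtop : ∀ x y, w x y ≠ ∞) {α β : ℝ} (hα : 1 < α)
    (hβ : 1 ≤ β) {R : ℝ≥0∞}
    (hR : ∀ (n : ℕ) (ρ : Fin n → Measure A), IsProbabilityMeasure (∑ u, ρ u) →
      gainRatio α β ν w ρ ≤ R)
    {ι : Type*} [Fintype ι] {p : ι → ℝ≥0∞} (hp : ∑ i, p i = 1) (x : ι → A) (x' : A) :
    leakageIntegral α β ν w x' (∑ i, p i • Measure.dirac (x i)) ≤ R := by
  rcases eq_or_ne R ∞ with rfl | hRtop
  · exact le_top
  have hα0 : 0 < α := by linarith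
  have hβ0 : 0 < β := by linarith
  have hp1 : ∀ i, p i ≤ 1 := fun i => hp ▸ Finset.single_le_sum (fun _ _ => zero_le)
    (Finset.mem_univ i)
  set Z := ∑ i, p i ^ (1 / α) with hZ
  have hZ0 : Z ≠ 0 := by
    intro h
    have : ∀ i, p i = 0 := fun i => by
      simpa [hα0, hα0.not_gt] using (Finset.sum_eq_zero_iff.1 h) i (Finset.mem_univ i)
    simp [this] at hp
  have hZtop : Z ≠ ∞ := ENNReal.sum_ne_top.2 fun i _ =>
    ENNReal.rpow_ne_top_of_nonneg (by positivity) ((hp1 i).trans_lt ENNReal.one_lt_top).ne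
  let q : ι → ℝ≥0∞ := fun i => Z⁻¹ * p i ^ (1 / α)
  have hq : ∑ i, q i = 1 := by
    simp only [q]
    rw [← Finset.mul_sum]
    exact ENNReal.inv_mul_cancel hZ0 hZtop
  have hqp : ∀ i, q i ^ α = Z⁻¹ ^ α * p i := fun i => by
    simp only [q]
    rw [ENNReal.mul_rpow_of_nonneg _ _ hα0.le, ← ENNReal.rpow_mul, one_div_mul_cancel hα0.ne',
      ENNReal.rpow_one]
  have hqtop : ∀ i, q i ≠ ∞ := fun i =>
    ((hq ▸ Finset.single_le_sum (fun _ _ => zero_le) (Finset.mem_univ i) :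
      q i ≤ 1).trans_lt ENNReal.one_lt_top).ne
  let ε : ℕ → ℝ≥0∞ := fun j => ((j + 1 : ℕ) : ℝ≥0∞)⁻¹
  have hε0 : Filter.Tendsto ε Filter.atTop (nhds 0) :=
    ENNReal.tendsto_inv_nat_nhds_zero.comp (Filter.tendsto_add_atTop_nat 1)
  let G : ℕ → B → ℝ≥0∞ := fun j y =>
    (ε j * ∑ i, q i * w (x i) y + (1 - ε j) * w x' y) ^ (1 - β) *
      (∑ i, p i * w (x i) y ^ α) ^ (β / α)
  have hG : ∀ j, ∫⁻ y, G j y ∂ν ≤ R := fun j =>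
    lintegral_mix_rpow_le hw hα hβ hRtop hR hp hq (ENNReal.inv_ne_zero.2 hZtop)
      (ENNReal.inv_ne_top.2 hZ0) hqp x x' (ENNReal.inv_ne_zero.2 (ENNReal.natCast_ne_top _))
      (ENNReal.inv_le_one.2 (by exact_mod_cast Nat.succ_pos j))
  have hwm : ∀ z, Measurable (w z) := fun z => hw.of_uncurry_left
  have hGm : ∀ j, Measurable (G j) := fun j => by fun_prop
  have hpt : ∀ y, w x' y ^ (1 - β) *
      (∫⁻ z, w z y ^ α ∂(∑ i, p i • Measure.dirac (x i))) ^ (β / α) ≤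
        Filter.liminf (fun j => G j y) Filter.atTop := fun y => by
    have hF : ∫⁻ z, w z y ^ α ∂(∑ i, p i • Measure.dirac (x i)) = ∑ i, p i * w (x i) y ^ α := by
      simp_rw [lintegral_finsetSum_measure, lintegral_smul_measure,
        lintegral_dirac' _ (hw.of_uncurry_right.pow_const α), smul_eq_mul]
    have hC : ∑ i, q i * w (x i) y ≠ ∞ :=
      ENNReal.sum_ne_top.2 fun i _ => ENNReal.mul_ne_top (hqtop i) (hwtop _ _)
    have ht : Filter.Tendsto (fun j => ε j * ∑ i, q i * w (x i) y + (1 - ε j) * w x' y)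
        Filter.atTop (nhds (w x' y)) := by
      have h1 := ENNReal.Tendsto.mul_const hε0 (Or.inr hC)
      have h2 := ENNReal.Tendsto.mul_const (b := w x' y)
        (ENNReal.Tendsto.sub (tendsto_const_nhds (x := (1 : ℝ≥0∞))) hε0 (Or.inl ENNReal.one_ne_top))
        (Or.inr (hwtop x' y))
      simpa using h1.add h2
    have ht' : Filter.Tendsto
        (fun j => (ε j * ∑ i, q i * w (x i) y + (1 - ε j) * w x' y) ^ (1 - β))
        Filter.atTop (nhds (w x' y ^ (1 - β))) :=
      ((ENNReal.continuous_rpow_const (y := 1 - β)).tendsto _).comp ht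
    have h := ENNReal.le_liminf_mul (f := Filter.atTop)
      (u := fun j => (ε j * ∑ i, q i * w (x i) y + (1 - ε j) * w x' y) ^ (1 - β))
      (v := fun _ => (∑ i, p i * w (x i) y ^ α) ^ (β / α))
    rw [Filter.liminf_const, ht'.liminf_eq] at h
    rw [hF]
    exact h
  calc leakageIntegral α β ν w x' (∑ i, p i • Measure.dirac (x i))
      ≤ ∫⁻ y, Filter.liminf (fun j => G j y) Filter.atTop ∂ν := lintegral_mono hpt
    _ ≤ Filter.liminf (fun j => ∫⁻ y, G j y ∂ν) Filter.atTop := lintegral_liminf_le hGm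
    _ ≤ R := by
      refine (Filter.liminf_le_liminf (Filter.Eventually.of_forall hG)).trans ?_
      rw [Filter.liminf_const]

end Reduction

/-! ### Escape of mass and continuity of the marginal density -/

open Filter Topology

/-- Functions of integral at least `η` that tend to zero pointwise are asymptotically disjoint: the
supremum of `N` suitable ones has integral at least `N * (η / 2)`. -/
theorem exists_finset_le_lintegral_sup {B : Type*} [MeasurableSpace B] {ν : Measure B}
    {h : ℕ → B → ℝ≥0∞} (hm : ∀ i, Measurable (h i))
    (h0 : ∀ y, Tendsto (fun i => h i y) atTop (𝓝 0)) {η : ℝ≥0∞} (hη0 : η ≠ 0) (hηtop : η ≠ ∞)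
    (hη : ∀ i, η ≤ ∫⁻ y, h i y ∂ν) (hfin : ∀ i, ∫⁻ y, h i y ∂ν ≠ ∞) (N : ℕ) :
    ∃ s : Finset ℕ, s.card = N ∧ N * (η / 2) ≤ ∫⁻ y, s.sup (fun i => h i y) ∂ν := by
  induction N with
  | zero => exact ⟨∅, by simp⟩
  | succ N ih =>
    obtain ⟨s, hs, hle⟩ := ih
    have hMm : Measurable fun y => s.sup fun i => h i y := by
      simp_rw [Finset.sup_eq_iSup]
      exact Measurable.biSup _ s.countable_toSet fun i _ => hm i
    have hMfin : ∫⁻ y, s.sup (fun i => h i y) ∂ν ≠ ∞ := by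
      refine ne_top_of_le_ne_top (b := ∑ i ∈ s, ∫⁻ y, h i y ∂ν)
        (ENNReal.sum_ne_top.2 fun i _ => hfin i) ?_
      rw [← lintegral_finsetSum _ fun i _ => hm i]
      exact lintegral_mono fun y => Finset.sup_le fun i hi =>
        Finset.single_le_sum (f := fun i => h i y) (fun _ _ => zero_le) hi
    have hmin : Tendsto (fun i => ∫⁻ y, min (s.sup fun i => h i y) (h i y) ∂ν) atTop
        (𝓝 (∫⁻ _, 0 ∂ν)) := by
      refine tendsto_lintegral_of_dominated_convergence (fun y => s.sup fun i => h i y)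
        (fun i => hMm.min (hm i)) (fun i => Eventually.of_forall fun y => min_le_left _ _) hMfin
        (Eventually.of_forall fun y => ?_)
      exact tendsto_of_tendsto_of_tendsto_of_le_of_le tendsto_const_nhds (h0 y)
        (fun _ => zero_le) fun i => min_le_right _ _
    rw [lintegral_zero] at hmin
    have hη2 : 0 < η / 2 := ENNReal.half_pos hη0
    obtain ⟨i, hi, his⟩ := ((hmin.eventually (ge_mem_nhds hη2)).and
      (eventually_gt_atTop (s.sup id))).exists
    have hins : i ∉ s := fun hmem => absurd (Finset.le_sup (f := id) hmem) (not_le.2 his)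
    refine ⟨insert i s, by rw [Finset.card_insert_of_notMem hins, hs], ?_⟩
    simp_rw [Finset.sup_insert]
    have hη2top : η / 2 ≠ ∞ := ENNReal.div_ne_top hηtop two_ne_zero
    refine (ENNReal.add_le_add_iff_right hη2top).1 ?_
    calc ((N + 1 : ℕ) : ℝ≥0∞) * (η / 2) + η / 2 = N * (η / 2) + η := by
          nth_rewrite 4 [← ENNReal.add_halves η]
          push_cast; ring
      _ ≤ ∫⁻ y, s.sup (fun i => h i y) ∂ν + ∫⁻ y, h i y ∂ν := add_le_add hle (hη i)
      _ = ∫⁻ y, h i y ⊔ s.sup (fun i => h i y) ∂ν +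
          ∫⁻ y, min (s.sup fun i => h i y) (h i y) ∂ν := by
          have hmax : Measurable fun y => h i y ⊔ s.sup fun i => h i y := (hm i).sup hMm
          rw [← lintegral_add_left hMm, ← lintegral_add_left hmax]
          refine lintegral_congr fun y => ?_
          rw [max_comm, max_add_min]
      _ ≤ _ := by gcongr

section General

variable {A B : Type*} [MeasurableSpace A] [MeasurableSpace B] {ν : Measure B} {w : A → B → ℝ≥0∞}

/-- The leakage integral is at least its value for `β = 1`, raised to the power `β`. -/
theorem rpow_lintegral_le_leakageIntegral (hw : Measurable (Function.uncurry w))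
    (hwtop : ∀ x y, w x y ≠ ∞) (hw1 : ∀ x, ∫⁻ y, w x y ∂ν = 1) {α β : ℝ} (hβ : 1 ≤ β) (x' : A)
    (P : Measure A) [SFinite P] :
    (∫⁻ y, (∫⁻ x, w x y ^ α ∂P) ^ (1 / α) ∂ν) ^ β ≤ leakageIntegral α β ν w x' P := by
  have hF : Measurable fun y => ∫⁻ x, w x y ^ α ∂P := (hw.pow_const α).lintegral_prod_left'
  have h := rpow_lintegral_le_weighted (μ := ν) (w := w x')
    (φ := fun y => (∫⁻ x, w x y ^ α ∂P) ^ (1 / α)) hw.of_uncurry_left (hF.pow_const _)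
    (hwtop x') (by rw [hw1]; exact one_ne_zero) hβ
  rw [hw1, ENNReal.one_rpow, one_mul] at h
  refine h.trans (le_of_eq ?_)
  refine lintegral_congr fun y => ?_
  rw [← ENNReal.rpow_mul, one_div_mul_eq_div]

theorem rpow_le_leakageIntegral_uniform (hw : Measurable (Function.uncurry w))
    (hwtop : ∀ x y, w x y ≠ ∞) (hw1 : ∀ x, ∫⁻ y, w x y ∂ν = 1) {α β : ℝ} (hα : 1 < α)
    (hβ : 1 ≤ β) (x' : A) (Q : ℕ → Measure A) (hQ : ∀ i, IsProbabilityMeasure (Q i))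
    {h : ℕ → B → ℝ≥0∞} (hh : ∀ i y, h i y ≤ mixture w (Q i) y) (s : Finset ℕ) (hs : s.card ≠ 0) :
    ((s.card : ℝ≥0∞) ^ (-(1 / α)) * ∫⁻ y, s.sup (fun i => h i y) ∂ν) ^ β ≤
      leakageIntegral α β ν w x' (∑ i : s, (s.card : ℝ≥0∞)⁻¹ • Q i) := by
  have hα0 : 0 < α := by linarith
  have hfin : IsFiniteMeasure (∑ i : s, (s.card : ℝ≥0∞)⁻¹ • Q i) := ⟨by
    simp only [Measure.coe_finsetSum, Finset.sum_apply, Measure.smul_apply, measure_univ,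
      smul_eq_mul, mul_one]
    exact ENNReal.sum_lt_top.2 fun _ _ =>
      ENNReal.inv_lt_top.2 (by exact_mod_cast Nat.pos_of_ne_zero hs)⟩
  refine le_trans (ENNReal.rpow_le_rpow ?_ (by linarith))
    (rpow_lintegral_le_leakageIntegral hw hwtop hw1 hβ x' _)
  rw [← lintegral_const_mul' _ _ (ENNReal.rpow_ne_top_of_ne_zero (by exact_mod_cast hs)
    (ENNReal.natCast_ne_top _))]
  refine lintegral_mono fun y => ?_
  change _ * s.sup (fun i => h i y) ≤ _
  rcases s.eq_empty_or_nonempty with rfl | hne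
  · simp at hs
  obtain ⟨i, hi, hsup⟩ := Finset.exists_mem_eq_sup s hne fun i => h i y
  have h1 : (s.card : ℝ≥0∞)⁻¹ * h i y ^ α ≤
      ∫⁻ x, w x y ^ α ∂(∑ i : s, (s.card : ℝ≥0∞)⁻¹ • Q i) := by
    have h2 := mixture_rpow_le hw hα.le (Q i) y
    rw [measure_univ, ENNReal.one_rpow, one_mul] at h2
    rw [lintegral_finsetSum_measure]
    simp_rw [lintegral_smul_measure, smul_eq_mul]
    refine le_trans ?_ (Finset.single_le_sum
      (f := fun i : s => (s.card : ℝ≥0∞)⁻¹ * ∫⁻ x, w x y ^ α ∂(Q i)) (fun _ _ => zero_le)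
      (Finset.mem_univ ⟨i, hi⟩))
    exact mul_le_mul' le_rfl ((ENNReal.rpow_le_rpow (hh i y) hα0.le).trans h2)
  rw [hsup]
  refine le_trans (le_of_eq ?_) (ENNReal.rpow_le_rpow h1 (by positivity : 0 ≤ 1 / α))
  rw [ENNReal.mul_rpow_of_nonneg _ _ (by positivity), ← ENNReal.rpow_mul,
    mul_one_div_cancel hα0.ne', ENNReal.rpow_one, ENNReal.inv_rpow, ENNReal.rpow_neg]

/-- If the output laws of the inputs `Q i` have parts `h i` of mass at least `η` that tend to zero
pointwise, then uniform mixtures of the `Q i` have unbounded leakage integrals. -/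
theorem eq_top_of_escaping (hw : Measurable (Function.uncurry w))
    (hwtop : ∀ x y, w x y ≠ ∞) (hw1 : ∀ x, ∫⁻ y, w x y ∂ν = 1) [SFinite ν] {α β : ℝ} (hα : 1 < α)
    (hβ : 1 ≤ β) (x' : A) (Q : ℕ → Measure A) (hQ : ∀ i, IsProbabilityMeasure (Q i))
    {h : ℕ → B → ℝ≥0∞} (hm : ∀ i, Measurable (h i)) (hh : ∀ i y, h i y ≤ mixture w (Q i) y)
    (h0 : ∀ y, Tendsto (fun i => h i y) atTop (𝓝 0)) {η : ℝ≥0∞} (hη0 : η ≠ 0)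
    (hη : ∀ i, η ≤ ∫⁻ y, h i y ∂ν) {R : ℝ≥0∞}
    (hR : ∀ s : Finset ℕ, s.card ≠ 0 →
      leakageIntegral α β ν w x' (∑ i : s, (s.card : ℝ≥0∞)⁻¹ • Q i) ≤ R) : R = ∞ := by
  have hβ0 : 0 < β := by linarith
  have h1 : ∀ i, ∫⁻ y, h i y ∂ν ≤ 1 := fun i => by
    refine (lintegral_mono (hh i)).trans (le_of_eq ?_)
    rw [lintegral_mixture hw hw1, measure_univ]
  have hηtop : η ≠ ∞ := (((hη 0).trans (h1 0)).trans_lt ENNReal.one_lt_top).ne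
  have hle : ∀ k : ℕ, (((k + 1 : ℕ) : ℝ≥0∞) ^ (1 - 1 / α) * (η / 2)) ^ β ≤ R := by
    intro k
    obtain ⟨s, hs, hsle⟩ := exists_finset_le_lintegral_sup hm h0 hη0 hηtop hη
      (fun i => ((h1 i).trans_lt ENNReal.one_lt_top).ne) (k + 1)
    have hs0 : s.card ≠ 0 := by omega
    refine le_trans ?_ ((rpow_le_leakageIntegral_uniform hw hwtop hw1 hα hβ x' Q hQ hh s hs0).trans
      (hR s hs0))
    refine ENNReal.rpow_le_rpow ?_ hβ0.le
    rw [hs]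
    have hk0 : ((k + 1 : ℕ) : ℝ≥0∞) ≠ 0 := by exact_mod_cast k.succ_ne_zero
    calc ((k + 1 : ℕ) : ℝ≥0∞) ^ (1 - 1 / α) * (η / 2)
        = ((k + 1 : ℕ) : ℝ≥0∞) ^ (-(1 / α)) * (((k + 1 : ℕ) : ℝ≥0∞) * (η / 2)) := by
          rw [← mul_assoc]
          nth_rewrite 3 [← ENNReal.rpow_one ((k + 1 : ℕ) : ℝ≥0∞)]
          rw [← ENNReal.rpow_add _ _ hk0 (ENNReal.natCast_ne_top _)]
          congr 2; ring
      _ ≤ _ := by gcongr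
  have hlim : Tendsto (fun k : ℕ => (((k + 1 : ℕ) : ℝ≥0∞) ^ (1 - 1 / α) * (η / 2)) ^ β) atTop
      (𝓝 ∞) := by
    have hc : 0 < 1 - 1 / α := by
      rw [sub_pos, div_lt_one (by linarith)]; exact hα
    have t1 : Tendsto (fun k : ℕ => ((k + 1 : ℕ) : ℝ≥0∞)) atTop (𝓝 ∞) :=
      ENNReal.tendsto_nat_nhds_top.comp (tendsto_add_atTop_nat 1)
    have t2 := (ENNReal.tendsto_rpow_at_top hc).comp t1
    have t3 := ENNReal.Tendsto.mul_const (b := η / 2) t2 (Or.inl ENNReal.top_ne_zero)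
    rw [ENNReal.top_mul (ENNReal.half_pos hη0).ne'] at t3
    exact (ENNReal.tendsto_rpow_at_top hβ0).comp t3
  exact top_le_iff.1 (le_of_tendsto' hlim hle)

end General

section Normalized

variable {A B : Type*} [MeasurableSpace B] {ν : Measure B} {f : A → B → ℝ≥0}

/-- The conditional density obtained from a joint density by normalizing each section. -/
noncomputable def normalized (ν : Measure B) (f : A → B → ℝ≥0) (x : A) (y : B) : ℝ≥0∞ :=
  f x y / ∫⁻ z, f x z ∂ν

theorem measurable_normalized [MeasurableSpace A] [SFinite ν]
    (hf : Measurable (Function.uncurry f)) :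
    Measurable (Function.uncurry (normalized ν f)) := by
  have h1 : Measurable fun p : A × B => (f p.1 p.2 : ℝ≥0∞) := hf.coe_nnreal_ennreal
  exact h1.div ((Measurable.lintegral_prod_right' h1).comp measurable_fst)

theorem normalized_ne_top (hpos : ∀ x, ∫⁻ y, f x y ∂ν ≠ 0) (x : A) (y : B) :
    normalized ν f x y ≠ ∞ :=
  ENNReal.div_ne_top ENNReal.coe_ne_top (hpos x)

theorem lintegral_normalized (hf : ∀ x, Measurable (f x))
    (hpos : ∀ x, ∫⁻ y, f x y ∂ν ≠ 0) (hfin : ∀ x, ∫⁻ y, f x y ∂ν ≠ ∞) (x : A) :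
    ∫⁻ y, normalized ν f x y ∂ν = 1 := by
  simp only [normalized, div_eq_mul_inv]
  rw [lintegral_mul_const _ (hf x).coe_nnreal_ennreal]
  exact ENNReal.mul_inv_cancel (hpos x) (hfin x)

end Normalized

section Topological

variable {A B : Type*} [PseudoMetricSpace A] [MeasurableSpace B] {ν : Measure B} {f : A → B → ℝ≥0}

theorem lowerSemicontinuous_lintegral (hf : ∀ x, Measurable (f x))
    (hcont : ∀ y, Continuous fun x => f x y) :
    LowerSemicontinuous fun x => ∫⁻ y, f x y ∂ν := by
  intro x
  refine lowerSemicontinuousAt_iff_le_liminf.2 ?_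
  refine le_trans (lintegral_mono fun y => ?_)
    (lintegral_liminf_le fun z => (hf z).coe_nnreal_ennreal)
  exact ((ENNReal.continuous_coe.comp (hcont y)).tendsto x).liminf_eq.ge

/-- If the leakage integrals of finite mixtures of `𝒬` are bounded, the marginal density is
continuous: an upward jump at `x₀` would make mass escape. -/
theorem continuous_lintegral_of_leakageIntegral_le [MeasurableSpace A] [SFinite ν]
    (hf : Measurable (Function.uncurry f)) (hcont : ∀ y, Continuous fun x => f x y)
    (hpos : ∀ x, ∫⁻ y, f x y ∂ν ≠ 0) (hfin : ∀ x, ∫⁻ y, f x y ∂ν ≠ ∞)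
    {α β : ℝ} (hα : 1 < α) (hβ : 1 ≤ β) (𝒬 : Set (Measure A))
    (hprob : ∀ Q ∈ 𝒬, IsProbabilityMeasure Q)
    (hloc : ∀ U : Set A, IsOpen U → U.Nonempty → ∃ Q ∈ 𝒬, Q Uᶜ = 0) {R : ℝ≥0∞} (hRtop : R ≠ ∞)
    (hR : ∀ (x' : A) (ι : Type) (_ : Fintype ι) (p : ι → ℝ≥0∞) (Q : ι → Measure A),
      ∑ i, p i = 1 → (∀ i, Q i ∈ 𝒬) →
        leakageIntegral α β ν (normalized ν f) x' (∑ i, p i • Q i) ≤ R) :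
    Continuous fun x => ∫⁻ y, f x y ∂ν := by
  set m : A → ℝ≥0∞ := fun x => ∫⁻ y, f x y ∂ν with hm
  have hlsc : LowerSemicontinuous m := lowerSemicontinuous_lintegral
    (fun x => hf.of_uncurry_left) hcont
  refine continuous_iff_lower_upperSemicontinuous.2 ⟨hlsc, fun x₀ => ?_⟩
  by_contra hnot
  obtain ⟨c, hc, hfreq⟩ : ∃ c, m x₀ < c ∧ ∃ᶠ x in 𝓝 x₀, ¬ m x < c := by
    simpa only [SemicontinuousAt, not_forall, exists_prop, Filter.not_eventually] using hnot
  obtain ⟨c', hc', hc'c⟩ := exists_between hc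
  have hc'0 : c' ≠ 0 := (zero_le.trans_lt hc').ne'
  have hc'top : c' ≠ ∞ := (hc'c.trans_le le_top).ne
  have hex : ∀ i : ℕ, ∃ Q ∈ 𝒬, Q (Metric.ball x₀ (1 / (i + 1 : ℝ)) ∩ {x | c' < m x})ᶜ = 0 := by
    intro i
    have hr : (0 : ℝ) < 1 / (i + 1 : ℝ) := Nat.one_div_pos_of_nat
    refine hloc _ (Metric.isOpen_ball.inter (hlsc.isOpen_preimage c')) ?_
    obtain ⟨x, hx, hxb⟩ := (hfreq.and_eventually (Metric.ball_mem_nhds x₀ hr)).exists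
    exact ⟨x, hxb, hc'c.trans_le (not_lt.1 hx)⟩
  choose Q hQ hQU using hex
  have hQp : ∀ i, IsProbabilityMeasure (Q i) := fun i => hprob _ (hQ i)
  have hw := measurable_normalized (ν := ν) hf
  have hw1 := lintegral_normalized (fun x => hf.of_uncurry_left) hpos hfin
  set w := normalized ν f with hwdef
  have hθ : m x₀ / c' < 1 := by
    rw [ENNReal.div_lt_iff (Or.inl hc'0) (Or.inl hc'top), one_mul]; exact hc'
  have hwm : Measurable (w x₀) := hw.of_uncurry_left
  have hxy : ∀ y, m x₀ / c' * w x₀ y = f x₀ y / c' := fun y => by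
    simp only [hwdef, normalized]
    change m x₀ / c' * (f x₀ y / m x₀) = _
    rw [← ENNReal.mul_div_right_comm, ENNReal.mul_div_cancel (hpos x₀) (hfin x₀)]
  -- with `θ = m x₀ / c' < 1`, the output density of `Q i` has pointwise limit superior at most
  -- `θ * w x₀`, so its part above `θ * w x₀`, of mass at least `1 - θ`, escapes
  refine hRtop (eq_top_of_escaping hw (normalized_ne_top hpos) hw1 hα hβ x₀ Q hQp
    (h := fun i y => mixture w (Q i) y - m x₀ / c' * w x₀ y) (η := 1 - m x₀ / c')
    (fun i => (measurable_mixture hw _).sub (hwm.const_mul _)) (fun i y => tsub_le_self)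
    (fun y => ?_) (tsub_pos_of_lt hθ).ne' (fun i => ?_) (fun s hs => ?_))
  · -- `w x y ≤ f x y / c'` on the support of `Q i`, and `f x y` tends to `f x₀ y`
    rw [ENNReal.tendsto_nhds_zero]
    intro δ hδ
    have hlt : (f x₀ y : ℝ≥0∞) < f x₀ y + δ * c' :=
      ENNReal.lt_add_right ENNReal.coe_ne_top (mul_ne_zero hδ.ne' hc'0)
    have hev : ∀ᶠ x in 𝓝 x₀, (f x y : ℝ≥0∞) < f x₀ y + δ * c' :=
      ((ENNReal.continuous_coe.comp (hcont y)).tendsto x₀).eventually_lt_const hlt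
    obtain ⟨r, hr, hball⟩ := Metric.eventually_nhds_iff_ball.1 hev
    filter_upwards [(tendsto_one_div_add_atTop_nhds_zero_nat (𝕜 := ℝ)).eventually_lt_const hr]
      with i hi
    rw [tsub_le_iff_left, hxy]
    have hae : ∀ᵐ x ∂(Q i), w x y ≤ f x₀ y / c' + δ := by
      filter_upwards [compl_mem_ae_iff.2 (hQU i)] with x hx
      rw [compl_compl] at hx
      have h1 : (f x y : ℝ≥0∞) ≤ f x₀ y + δ * c' :=
        (hball x (Metric.ball_subset_ball hi.le hx.1)).le
      calc w x y ≤ (f x₀ y + δ * c') / c' := ENNReal.div_le_div h1 (le_of_lt hx.2)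
        _ = _ := by rw [ENNReal.add_div, ENNReal.mul_div_cancel_right hc'0 hc'top]
    calc mixture w (Q i) y ≤ ∫⁻ _, (f x₀ y / c' + δ) ∂(Q i) := lintegral_mono_ae hae
      _ = _ := by simp
  · rw [tsub_le_iff_right]
    have h1 : ∫⁻ y, mixture w (Q i) y ∂ν = 1 := by
      rw [lintegral_mixture hw hw1, measure_univ]
    have h2 : ∫⁻ y, m x₀ / c' * w x₀ y ∂ν = m x₀ / c' := by
      rw [lintegral_const_mul _ hwm, hw1, mul_one]
    calc 1 = ∫⁻ y, mixture w (Q i) y ∂ν := h1.symm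
      _ ≤ ∫⁻ y, (mixture w (Q i) y - m x₀ / c' * w x₀ y) + m x₀ / c' * w x₀ y ∂ν :=
          lintegral_mono fun y => le_tsub_add
      _ = _ := by rw [lintegral_add_right _ (hwm.const_mul _), h2]
  · refine hR x₀ s _ (fun _ => (s.card : ℝ≥0∞)⁻¹) (fun i => Q i) ?_ fun i => hQ i
    simp only [Finset.sum_const, Finset.card_univ, Fintype.card_coe, nsmul_eq_mul]
    exact ENNReal.mul_inv_cancel (by exact_mod_cast hs) (ENNReal.natCast_ne_top _)

end Topological

/-! ### Approximation by finite mixtures -/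

theorem le_liminf_rpow {u : ℕ → ℝ≥0∞} {t r : ℝ≥0∞} {s : ℝ} (hs : 0 ≤ s)
    (h : t ≤ liminf u atTop) : r * t ^ s ≤ liminf (fun k => r * u k ^ s) atTop := by
  have h1 : t ^ s ≤ liminf (fun k => u k ^ s) atTop := by
    refine (ENNReal.rpow_le_rpow h hs).trans (le_of_eq ?_)
    exact (ENNReal.monotone_rpow_of_nonneg hs).map_liminf_of_continuousAt u
      ENNReal.continuous_rpow_const.continuousAt
  calc r * t ^ s ≤ liminf (fun _ => r) (atTop : Filter ℕ) * liminf (fun k => u k ^ s) atTop := by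
        rw [liminf_const]; gcongr
    _ ≤ _ := ENNReal.le_liminf_mul

/-- Lower semicontinuity of the leakage integral in the input distribution, by Fatou's lemma. -/
theorem leakageIntegral_le_of_le_liminf {A B : Type*} [MeasurableSpace A] [MeasurableSpace B]
    {ν : Measure B} {w : A → B → ℝ≥0∞} (hw : Measurable (Function.uncurry w)) {α β : ℝ}
    (hαβ : 0 ≤ β / α) {x' : A} {P : Measure A} {M : ℕ → Measure A} (hM : ∀ k, SFinite (M k))
    {R : ℝ≥0∞} (hR : ∀ k, leakageIntegral α β ν w x' (M k) ≤ R)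
    (hlim : ∀ y, ∫⁻ x, w x y ^ α ∂P ≤ liminf (fun k => ∫⁻ x, w x y ^ α ∂(M k)) atTop) :
    leakageIntegral α β ν w x' P ≤ R := by
  have hw' : Measurable (w x') := hw.of_uncurry_left
  have hF : ∀ k, Measurable fun y => ∫⁻ x, w x y ^ α ∂(M k) := fun k =>
    (hw.pow_const α).lintegral_prod_left'
  calc leakageIntegral α β ν w x' P
      ≤ ∫⁻ y, liminf (fun k => w x' y ^ (1 - β) * (∫⁻ x, w x y ^ α ∂(M k)) ^ (β / α)) atTop ∂ν :=
        lintegral_mono fun y => le_liminf_rpow hαβ (hlim y)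
    _ ≤ liminf (fun k => leakageIntegral α β ν w x' (M k)) atTop :=
        lintegral_liminf_le fun k => (hw'.pow_const _).mul ((hF k).pow_const _)
    _ ≤ R := by
      refine (liminf_le_liminf (Eventually.of_forall hR)).trans ?_
      rw [liminf_const]

theorem le_liminf_lintegral_of_concentrated {A : Type*} [PseudoMetricSpace A] [MeasurableSpace A]
    {h : A → ℝ≥0∞} {x : A} (hc : ContinuousAt h x) {z : ℕ → A} (hz : Tendsto z atTop (𝓝 x))
    {Q : ℕ → Measure A} (hQ : ∀ k, IsProbabilityMeasure (Q k))
    (hball : ∀ k, Q k (Metric.ball (z k) (1 / (k + 1 : ℝ)))ᶜ = 0) :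
    h x ≤ liminf (fun k => ∫⁻ a, h a ∂(Q k)) atTop := by
  refine le_of_forall_lt_imp_le_of_dense fun c hcx => ?_
  obtain ⟨r, hr, hsub⟩ := Metric.eventually_nhds_iff_ball.1 (hc.eventually_const_lt hcx)
  refine le_liminf_of_le (by isBoundedDefault) ?_
  filter_upwards [hz.eventually (Metric.ball_mem_nhds x (half_pos hr)),
    (tendsto_one_div_add_atTop_nhds_zero_nat (𝕜 := ℝ)).eventually_lt_const (half_pos hr)]
    with k hk hk'
  have hae : ∀ᵐ a ∂(Q k), c ≤ h a := by
    filter_upwards [compl_mem_ae_iff.2 (hball k)] with a ha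
    rw [compl_compl, Metric.mem_ball] at ha
    refine (hsub a ?_).le
    change dist (z k) x < r / 2 at hk
    rw [Metric.mem_ball]
    linarith [dist_triangle a (z k) x]
  calc c = ∫⁻ _, c ∂(Q k) := by simp
    _ ≤ _ := lintegral_mono_ae hae

/-- The supremum of the leakage integral over all distributions equals that over the finite mixtures
of any family `𝒬` that has a member living on each nonempty open set. -/
theorem leakageIntegral_le_of_mixtures {A : Type} {B : Type*} [PseudoMetricSpace A]
    [SecondCountableTopology A] [MeasurableSpace A] [BorelSpace A] [MeasurableSpace B]
    {ν : Measure B} [SFinite ν] {f : A → B → ℝ≥0}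
    (hf : Measurable (Function.uncurry f)) (hcont : ∀ y, Continuous fun x => f x y)
    (hpos : ∀ x, ∫⁻ y, f x y ∂ν ≠ 0) (hfin : ∀ x, ∫⁻ y, f x y ∂ν ≠ ∞)
    {α β : ℝ} (hα : 1 < α) (hβ : 1 ≤ β) (𝒬 : Set (Measure A))
    (hprob : ∀ Q ∈ 𝒬, IsProbabilityMeasure Q)
    (hloc : ∀ U : Set A, IsOpen U → U.Nonempty → ∃ Q ∈ 𝒬, Q Uᶜ = 0) {R : ℝ≥0∞}
    (hR : ∀ (x' : A) (ι : Type) (_ : Fintype ι) (p : ι → ℝ≥0∞) (Q : ι → Measure A),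
      ∑ i, p i = 1 → (∀ i, Q i ∈ 𝒬) →
        leakageIntegral α β ν (normalized ν f) x' (∑ i, p i • Q i) ≤ R)
    (x' : A) (P : Measure A) [IsProbabilityMeasure P] :
    leakageIntegral α β ν (normalized ν f) x' P ≤ R := by
  rcases eq_or_ne R ∞ with rfl | hRtop
  · exact le_top
  have hα0 : 0 < α := by linarith
  have hm := continuous_lintegral_of_leakageIntegral_le hf hcont hpos hfin hα hβ 𝒬 hprob hloc
    hRtop hR
  have hw := measurable_normalized (ν := ν) hf
  have hwcont : ∀ y, Continuous fun x => normalized ν f x y ^ α := fun y => by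
    refine ENNReal.continuous_rpow_const.comp (continuous_iff_continuousAt.2 fun x => ?_)
    exact ENNReal.Tendsto.div ((ENNReal.continuous_coe.comp (hcont y)).tendsto x)
      (Or.inr (hpos x)) (hm.tendsto x) (Or.inl (hfin x))
  set w := normalized ν f
  have hex : ∀ (z : A) (k : ℕ), ∃ Q ∈ 𝒬, Q (Metric.ball z (1 / (k + 1 : ℝ)))ᶜ = 0 := fun z k =>
    hloc _ Metric.isOpen_ball ⟨z, Metric.mem_ball_self Nat.one_div_pos_of_nat⟩
  choose Q hQ hQb using hex
  have hQp : ∀ z k, IsProbabilityMeasure (Q z k) := fun z k => hprob _ (hQ z k)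
  let s : ℕ → SimpleFunc A A := SimpleFunc.approxOn id measurable_id Set.univ x' (Set.mem_univ x')
  have hs : ∀ x, Tendsto (fun k => s k x) atTop (𝓝 x) := fun x =>
    SimpleFunc.tendsto_approxOn measurable_id (Set.mem_univ x') (by simp)
  -- replace `x` by the simple approximation `s k x`, and this by a member of `𝒬` close to it
  let M : ℕ → Measure A := fun k => ∑ z : (s k).range, P (s k ⁻¹' {(z : A)}) • Q z k
  have hMint : ∀ k (h : A → ℝ≥0∞),
      ∫⁻ a, h a ∂(M k) = ∫⁻ x, ∫⁻ a, h a ∂(Q (s k x) k) ∂P := fun k h => by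
    have h1 := SimpleFunc.map_lintegral (μ := P) (fun z => ∫⁻ a, h a ∂(Q z k)) (s k)
    rw [← SimpleFunc.lintegral_eq_lintegral] at h1
    simp only [SimpleFunc.coe_map, Function.comp] at h1
    rw [h1]
    simp only [M]
    rw [lintegral_finsetSum_measure]
    simp_rw [lintegral_smul_measure, smul_eq_mul]
    rw [Finset.sum_coe_sort (s k).range
      (fun z => P (s k ⁻¹' {z}) * ∫⁻ a, h a ∂(Q z k))]
    exact Finset.sum_congr rfl fun z _ => mul_comm _ _
  have hp : ∀ k, ∑ z : (s k).range, P (s k ⁻¹' {(z : A)}) = 1 := fun k => by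
    have h1 := hMint k fun _ => 1
    simpa [M] using h1
  have hMp : ∀ k, IsProbabilityMeasure (M k) := fun k => ⟨by simpa using hMint k fun _ => 1⟩
  refine leakageIntegral_le_of_le_liminf hw (by positivity) (M := M) (fun k => inferInstance)
    (fun k => hR x' _ _ _ _ (hp k) fun z => hQ z k) fun y => ?_
  simp_rw [hMint]
  calc ∫⁻ x, w x y ^ α ∂P
      ≤ ∫⁻ x, liminf (fun k => ∫⁻ a, w a y ^ α ∂(Q (s k x) k)) atTop ∂P :=
        lintegral_mono fun x => le_liminf_lintegral_of_concentrated (hwcont y).continuousAt (hs x)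
          (fun k => hQp _ k) fun k => hQb _ k
    _ ≤ _ := lintegral_liminf_le fun k =>
        ((s k).map fun z => ∫⁻ a, w a y ^ α ∂(Q z k)).measurable

/-! ### Densities on the input alphabet -/

theorem mul_log_le_iff {c : ℝ} (hc : 0 < c) {t : ℝ≥0∞} {Z : EReal} :
    (c : EReal) * ENNReal.log t ≤ Z ↔ t ≤ EReal.exp (Z / c) := by
  have hc' : (0 : EReal) < c := by exact_mod_cast hc
  rw [mul_comm, ← EReal.le_div_iff_mul_le hc' (EReal.coe_ne_top c), ← EReal.exp_le_exp_iff,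
    ENNReal.exp_log]

/-- The measure with density `g` on `S`, as a measure on the subtype. -/
noncomputable def pdfMeasure (S : Set ℝ) (g : ℝ → ℝ≥0∞) : Measure S :=
  (Measure.comap ((↑) : S → ℝ) volume).withDensity fun x => g x

theorem lintegral_pdfMeasure {S : Set ℝ} (hS : MeasurableSet S) {g h : ℝ → ℝ≥0∞}
    (hg : Measurable g) (hh : Measurable h) :
    ∫⁻ x, h x ∂(pdfMeasure S g) = ∫⁻ x in S, g x * h x := by
  have hg' : Measurable fun x : S => g x := hg.comp measurable_subtype_coe
  have hh' : Measurable fun x : S => h x := hh.comp measurable_subtype_coe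
  rw [pdfMeasure, lintegral_withDensity_eq_lintegral_mul _ hg' hh', ← lintegral_subtype_comap hS]
  rfl

theorem isProbabilityMeasure_pdfMeasure {S : Set ℝ} (hS : MeasurableSet S) {g : ℝ → ℝ≥0∞}
    (hg : IsPDFOn S g) : IsProbabilityMeasure (pdfMeasure S g) := ⟨by
  have := lintegral_pdfMeasure hS hg.1 (measurable_const (a := (1 : ℝ≥0∞)))
  simpa [hg.2] using this⟩

theorem isPDFOn_sum {S : Set ℝ} {ι : Type*} [Fintype ι] {p : ι → ℝ≥0∞} (hp : ∑ i, p i = 1)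
    {g : ι → ℝ → ℝ≥0∞} (hg : ∀ i, IsPDFOn S (g i)) :
    IsPDFOn S fun x => ∑ i, p i * g i x := by
  refine ⟨Finset.measurable_fun_sum _ fun i _ => (hg i).1.const_mul _, ?_⟩
  rw [lintegral_finsetSum _ fun i _ => (hg i).1.const_mul _]
  simp_rw [lintegral_const_mul _ (hg _).1, (hg _).2, mul_one]
  exact hp

theorem lintegral_sum_pdfMeasure {S : Set ℝ} (hS : MeasurableSet S) {ι : Type*} [Fintype ι]
    (p : ι → ℝ≥0∞) {g : ι → ℝ → ℝ≥0∞} (hg : ∀ i, Measurable (g i)) {h : ℝ → ℝ≥0∞}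
    (hh : Measurable h) :
    ∫⁻ x, h x ∂(∑ i, p i • pdfMeasure S (g i)) = ∫⁻ x in S, (∑ i, p i * g i x) * h x := by
  rw [lintegral_finsetSum_measure]
  simp_rw [lintegral_smul_measure, smul_eq_mul, lintegral_pdfMeasure hS (hg _) hh, Finset.sum_mul,
    mul_assoc]
  have hm : ∀ i, Measurable fun x => g i x * h x := fun i => (hg i).mul hh
  rw [lintegral_finsetSum _ fun i _ => (hm i).const_mul _]
  exact Finset.sum_congr rfl fun i _ => (lintegral_const_mul _ (hm i)).symm

theorem exists_pdfMeasure_compl_eq_zero {S U : Set ℝ}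
    (hU : MeasurableSet U) (hpos : volume (U ∩ S) ≠ 0) (hfin : volume (U ∩ S) ≠ ∞) :
    ∃ g, IsPDFOn S g ∧ pdfMeasure S g ((↑) ⁻¹' U : Set S)ᶜ = 0 := by
  have hg : Measurable (U.indicator fun _ => (volume (U ∩ S))⁻¹) :=
    measurable_const.indicator hU
  refine ⟨U.indicator fun _ => (volume (U ∩ S))⁻¹, ⟨hg, ?_⟩, ?_⟩
  · rw [lintegral_indicator hU, setLIntegral_const, Measure.restrict_apply hU]
    exact ENNReal.inv_mul_cancel hpos hfin
  · have hm : MeasurableSet ((↑) ⁻¹' U : Set S)ᶜ := (measurable_subtype_coe hU).compl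
    rw [pdfMeasure, withDensity_apply _ hm]
    refine (setLIntegral_congr_fun (g := fun _ => 0) hm fun x hx => ?_).trans lintegral_zero
    exact Set.indicator_of_notMem (s := U) (f := fun _ => (volume (U ∩ S))⁻¹) hx

section Alphabet

variable {f : ℝ × ℝ → ℝ≥0}

theorem measurable_marginalPDF (hf : Measurable f) : Measurable (marginalPDF f) :=
  Measurable.lintegral_prod_right' hf.coe_nnreal_ennreal

theorem measurableSet_inputAlphabet (hf : Measurable f) : MeasurableSet (inputAlphabet f) :=
  (measurableSet_lt measurable_const (measurable_marginalPDF hf)).inter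
    (measurableSet_lt (measurable_marginalPDF hf) measurable_const)

theorem inputAlphabet_subset {𝒳 𝒴 : Set ℝ} (hf0 : ∀ p, p ∉ 𝒳 ×ˢ 𝒴 → f p = 0) :
    inputAlphabet f ⊆ 𝒳 := by
  intro x hx
  by_contra hx𝒳
  have : marginalPDF f x = 0 := by
    simp only [marginalPDF]
    simp [hf0 (x, _) fun h => hx𝒳 h.1]
  exact hx.1.ne' this

theorem measurable_of_continuousOn_of_zero {s : Set (ℝ × ℝ)} (hs : MeasurableSet s)
    (hf : ContinuousOn f s) (hf0 : ∀ p, p ∉ s → f p = 0) : Measurable f := by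
  refine measurable_of_restrict_of_restrict_compl hs
    (continuousOn_iff_continuous_domRestrict.1 hf).measurable ?_
  have : sᶜ.domRestrict f = fun _ => 0 := funext fun p => hf0 p p.2
  rw [this]
  exact measurable_const

theorem continuous_section {𝒳 𝒴 : Set ℝ} (hf : ContinuousOn f (𝒳 ×ˢ 𝒴))
    (hf0 : ∀ p, p ∉ 𝒳 ×ˢ 𝒴 → f p = 0) {S : Set ℝ} (hS : S ⊆ 𝒳) (y : ℝ) :
    Continuous fun x : S => f (x, y) := by
  by_cases hy : y ∈ 𝒴
  · exact hf.comp_continuous (by fun_prop) fun x => ⟨hS x.2, hy⟩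
  · have : (fun x : S => f (x, y)) = fun _ => 0 := funext fun x => hf0 _ fun h => hy h.2
    rw [this]
    exact continuous_const

theorem ae_marginalPDF_lt_top (hf : Measurable f) (h : ∫⁻ p, f p ∂(volume : Measure (ℝ × ℝ)) = 1) :
    ∀ᵐ x, marginalPDF f x < ∞ := by
  refine ae_lt_top (measurable_marginalPDF hf) ?_
  have : ∫⁻ x, marginalPDF f x = 1 := by
    rw [← h, Measure.volume_eq_prod, lintegral_prod _ hf.coe_nnreal_ennreal.aemeasurable]
    rfl
  rw [this]
  exact ENNReal.one_ne_top

/-- Every point of the alphabet is surrounded by a set of positive length of points of the alphabet: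
the marginal density stays positive near it within `𝒳`, and it is finite almost everywhere. -/
theorem volume_inter_inputAlphabet_pos {𝒳 𝒴 : Set ℝ} (h𝒳int : 𝒳 ⊆ closure (interior 𝒳))
    (hfm : Measurable f) (hf : ContinuousOn f (𝒳 ×ˢ 𝒴)) (hf0 : ∀ p, p ∉ 𝒳 ×ˢ 𝒴 → f p = 0)
    (hint : ∫⁻ p, f p ∂(volume : Measure (ℝ × ℝ)) = 1) {V : Set ℝ} (hV : IsOpen V) {x₀ : ℝ}
    (hxV : x₀ ∈ V) (hx₀ : x₀ ∈ inputAlphabet f) : volume (V ∩ inputAlphabet f) ≠ 0 := by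
  have hlsc : LowerSemicontinuous fun x : 𝒳 => marginalPDF f x :=
    lowerSemicontinuous_lintegral (f := fun (x : 𝒳) y => f (x, y))
      (fun x => hfm.comp measurable_prodMk_left) (continuous_section hf hf0 subset_rfl)
  obtain ⟨V', hV', hVV'⟩ := isOpen_induced_iff.1 (hlsc.isOpen_preimage 0)
  have hmem : ∀ (x : ℝ) (hx : x ∈ 𝒳), x ∈ V' ↔ 0 < marginalPDF f x := fun x hx => by
    have := Set.ext_iff.1 hVV' ⟨x, hx⟩
    simpa using this
  have hx₀𝒳 : x₀ ∈ 𝒳 := inputAlphabet_subset hf0 hx₀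
  have hO : IsOpen (V ∩ V') := hV.inter hV'
  have hne : (V ∩ V' ∩ interior 𝒳).Nonempty :=
    mem_closure_iff.1 (h𝒳int hx₀𝒳) _ hO ⟨hxV, (hmem x₀ hx₀𝒳).2 hx₀.1⟩
  have hpos := (hO.inter isOpen_interior).measure_pos volume hne
  refine (hpos.trans_le (measure_mono_ae ?_)).ne'
  filter_upwards [ae_marginalPDF_lt_top hfm hint] with x hx hxm
  exact ⟨hxm.1.1, (hmem x (interior_subset hxm.2)).1 hxm.1.2, hx⟩

/-- The integral over `𝒴` is the integral over the whole line, since off `𝒴` the second factor is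
zero, which kills a first factor `0 ^ (1 - β) = ∞`. -/
theorem setLIntegral_eq_leakageIntegral {𝒴 : Set ℝ} (h𝒴 : MeasurableSet 𝒴)
    (hf0 : ∀ x y, y ∉ 𝒴 → f (x, y) = 0) {α β : ℝ} (hα : 0 < α) (hβ : 0 < β)
    {P : Measure (inputAlphabet f)} {g : ℝ → ℝ≥0∞} (x' : inputAlphabet f)
    (hP : ∀ y, ∫⁻ x, condPDF f x y ^ α ∂P = ∫⁻ x in inputAlphabet f, g x * condPDF f x y ^ α) :
    ∫⁻ y in 𝒴, condPDF f x' y ^ (1 - β) *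
        (∫⁻ x in inputAlphabet f, g x * condPDF f x y ^ α) ^ (β / α) =
      leakageIntegral α β volume (fun (x : inputAlphabet f) y => condPDF f x y) x' P := by
  rw [← lintegral_indicator h𝒴]
  refine lintegral_congr fun y => ?_
  rw [hP]
  by_cases hy : y ∈ 𝒴
  · rw [Set.indicator_of_mem hy]
  · rw [Set.indicator_of_notMem hy]
    simp [condPDF, hf0 _ y hy, hα, hβ]

end Alphabet
end AlphaBetaLeakage

open AlphaBetaLeakage in
theorem theorem6 {Ω : Type*} [MeasurableSpace Ω] (μ : Measure Ω) [IsProbabilityMeasure μ]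
    (X Y : Ω → ℝ) (hX : Measurable X) (hY : Measurable Y)
    (𝒳 𝒴 : Set ℝ) (h𝒳 : MeasurableSet 𝒳) (h𝒴 : MeasurableSet 𝒴)
    (h𝒳int : 𝒳 ⊆ closure (interior 𝒳))
    (f : ℝ × ℝ → ℝ≥0) (hf : ContinuousOn f (𝒳 ×ˢ 𝒴)) (hf0 : ∀ p, p ∉ 𝒳 ×ˢ 𝒴 → f p = 0)
    (hpdf : μ.map (fun ω => (X ω, Y ω)) = (volume : Measure (ℝ × ℝ)).withDensity
      (fun p => (f p : ℝ≥0∞)))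
    (α β : ℝ) (hα : 1 < α) (hβ : 1 ≤ β) :
    maximalLeakage α β (channel f) =
      ⨆ (x' : inputAlphabet f) (g : ℝ → ℝ≥0∞) (_ : IsPDFOn (inputAlphabet f) g),
        ((α / ((α - 1) * β) : ℝ) : EReal) *
          ENNReal.log (∫⁻ y in 𝒴, condPDF f x' y ^ (1 - β) *
            (∫⁻ x in inputAlphabet f, g x * condPDF f x y ^ α) ^ (β / α)) := by
  have hα0 : 0 < α := by linarith
  have hβ0 : 0 < β := by linarith
  have hc : 0 < α / ((α - 1) * β) := by
    have : 0 < α - 1 := by linarith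
    positivity
  have hfm : Measurable f := measurable_of_continuousOn_of_zero (h𝒳.prod h𝒴) hf hf0
  have hint : ∫⁻ p, f p ∂(volume : Measure (ℝ × ℝ)) = 1 := by
    rw [← setLIntegral_univ, ← withDensity_apply _ .univ, ← hpdf,
      Measure.map_apply (hX.prodMk hY) .univ]
    simp
  have hA := measurableSet_inputAlphabet hfm
  let F : inputAlphabet f → ℝ → ℝ≥0 := fun x y => f (x, y)
  have hF : Measurable (Function.uncurry F) :=
    hfm.comp ((measurable_subtype_coe.comp measurable_fst).prodMk measurable_snd)
  have hFcont : ∀ y, Continuous fun x => F x y :=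
    continuous_section hf hf0 (inputAlphabet_subset hf0)
  have hFpos : ∀ x, ∫⁻ y, F x y ≠ 0 := fun x => x.2.1.ne'
  have hFfin : ∀ x, ∫⁻ y, F x y ≠ ∞ := fun x => x.2.2.ne
  have hw := measurable_normalized (ν := volume) hF
  have hwtop := normalized_ne_top hFpos
  have hw1 := lintegral_normalized (fun x => hF.of_uncurry_left) hFpos hFfin
  have hcond : ∀ y, Measurable fun x => condPDF f x y ^ α := fun y =>
    (((hfm.comp measurable_prodMk_right).coe_nnreal_ennreal).div
      (measurable_marginalPDF hfm)).pow_const α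
  have hf𝒴 : ∀ x y, y ∉ 𝒴 → f (x, y) = 0 := fun x y hy => hf0 _ fun h => hy h.2
  have hL : maximalLeakage α β (channel f) = _ := maximalLeakage_eq_iSup hw hw1 hα hβ
  rw [hL]
  refine le_antisymm (iSup_le fun n => iSup₂_le fun ρ hρ => ?_)
    (iSup_le fun x' => iSup₂_le fun g hg => ?_)
  · rw [mul_log_le_iff hc]
    refine gainRatio_le hw hwtop hw1 hα hβ (fun x' P hP => ?_) ρ
    refine leakageIntegral_le_of_mixtures hF hFcont hFpos hFfin hα hβ
      {Q | ∃ g, IsPDFOn (inputAlphabet f) g ∧ Q = pdfMeasure (inputAlphabet f) g} ?_ ?_ ?_ x' P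
    · rintro Q ⟨g, hg, rfl⟩
      exact isProbabilityMeasure_pdfMeasure hA hg
    · rintro U hU ⟨x₀, hx₀⟩
      obtain ⟨V, hV, rfl⟩ := isOpen_induced_iff.1 hU
      have hVo : IsOpen (V ∩ Metric.ball (x₀ : ℝ) 1) := hV.inter Metric.isOpen_ball
      obtain ⟨g, hg, hg0⟩ := exists_pdfMeasure_compl_eq_zero hVo.measurableSet
        (volume_inter_inputAlphabet_pos h𝒳int hfm hf hf0 hint hVo
          ⟨hx₀, Metric.mem_ball_self one_pos⟩ x₀.2)
        (measure_ne_top_of_subset (Set.inter_subset_left.trans Set.inter_subset_right)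
          measure_ball_lt_top.ne)
      exact ⟨_, ⟨g, hg, rfl⟩, measure_mono_null
        (Set.compl_subset_compl.2 (Set.preimage_mono Set.inter_subset_left)) hg0⟩
    · intro x' ι _ p Q hp hQ
      choose g hg hgQ using hQ
      obtain rfl : Q = fun i => pdfMeasure (inputAlphabet f) (g i) := funext hgQ
      have h1 := setLIntegral_eq_leakageIntegral (β := β) h𝒴 hf𝒴 hα0 hβ0 x' fun y =>
        lintegral_sum_pdfMeasure hA p (fun i => (hg i).1) (hcond y)
      refine h1.ge.trans ((mul_log_le_iff hc).1 ?_)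
      exact le_iSup_of_le x' (le_iSup₂_of_le _ (isPDFOn_sum hp hg) le_rfl)
  · rw [mul_log_le_iff hc]
    have hgP := isProbabilityMeasure_pdfMeasure hA hg
    have h1 := setLIntegral_eq_leakageIntegral (β := β) h𝒴 hf𝒴 hα0 hβ0 x' fun y =>
        lintegral_pdfMeasure hA hg.1 (hcond y)
    refine h1.le.trans ?_
    refine leakageIntegral_le_of_mixtures hF hFcont hFpos hFfin hα hβ
      (Set.range Measure.dirac) ?_ ?_ ?_ x' _
    · rintro Q ⟨x, rfl⟩
      infer_instance
    · rintro U hU ⟨x, hx⟩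
      refine ⟨_, ⟨x, rfl⟩, ?_⟩
      rw [Measure.dirac_apply' _ hU.measurableSet.compl]
      simp [hx]
    · intro x' ι _ p Q hp hQ
      choose x hx using hQ
      obtain rfl : (fun i => Measure.dirac (x i)) = Q := funext hx
      refine leakageIntegral_dirac_le hw hwtop hα hβ (fun n ρ hρ => ?_) hp x x'
      rw [← mul_log_le_iff hc]
      exact le_iSup_of_le n (le_iSup₂_of_le ρ hρ le_rfl)
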